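/- **Conventions.** Let $N,M\ge 1$. For $I=(I_1,\dots,I_N)$ and $J=(J_1,\dots,J_M)$ write $\mathbb H^{I(N)\times J(M)}$ for the tensors of size $I_1\times\cdots\times I_N\times J_1\times\cdots\times J_M$ over the real quaternions $\mathbb H$. Products are Einstein products: for $\mathcal A\in\mathbb H^{I(N)\times J(M)}$, $\mathcal B\in\mathbb H^{J(M)\times K(L)}$, $(\mathcal A\mathcal B)_{i_1\ldots i_Nk_1\ldots k_L}=\sum_{j_1,\dots,j_M}a_{i_1\ldots i_Nj_1\ldots j_M}b_{j_1\ldots j_Mk_1\ldots k_L}$ (the symbols $*_N,*_M$ are omitted). $I$ is the unit tensor, $\mathcal D^*$ the conjugate transpose, and $\mathcal D^\dagger$ the Moore–Penrose inverse, i.e. the unique tensor with $\mathcal D\mathcal D^\dagger\mathcal D=\mathcal D$, $\mathcal D^\dagger\mathcal D\mathcal D^\dagger=\mathcal D^\dagger$, $(\mathcal D\mathcal D^\dagger)^*=\mathcal D\mathcal D^\dagger$, $(\mathcal D^\dagger\mathcal D)^*=\mathcal D^\dagger\mathcal D$. Put $R_{\mathcal D}=I-\mathcal D\mathcal D^\dagger$,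 $L_{\mathcal D}=I-\mathcal D^\dagger\mathcal D$. The row block tensor $(\mathcal A\ \ \mathcal B)$ of $\mathcal A\in\mathbb H^{I(N)\times J(M)}$ and $\mathcal B\in\mathbb H^{I(N)\times K(M)}$ lies in $\mathbb H^{I(N)\times (J+K)(M)}$; its entry at $(i,l)$ is $a_{i\,l}$ if $l_s\le J_s$ for all $s$, it is $b_{i\,(l-J)}$ if $l_s>J_s$ for all $s$, and $0$ otherwise. The column block tensor $\binom{\mathcal C}{\mathcal D}$ is defined in the same way in the first group of indices. **Theorem.** Let $A_1\in\mathbb H^{I(N)\times J(N)}$, $A_2\in\mathbb H^{I(N)\times Q(N)}$, $A_3\in\mathbb H^{I(N)\times P(N)}$, $A_6\in\mathbb H^{A(N)\times E(N)}$, $A_8\in\mathbb H^{C(N)\times R(N)}$, $B_1\in\mathbb H^{L(M)\times K(M)}$, $B_2\in\mathbb H^{S(M)\times K(M)}$, $B_3\in\mathbb H^{T(M)\times K(M)}$, $B_7\in\mathbb H^{H(M)\times B(M)}$, $B_9\in\mathbb H^{O(M)\times D(M)}$, $C_3\in\mathbb H^{A(N)\times J(N)}$, $C_4\in\mathbb H^{A(N)\times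 P(N)}$, $D_3\in\mathbb H^{L(M)\times B(M)}$, $D_4\in\mathbb H^{T(M)\times B(M)}$, $H_3\in\mathbb H^{C(N)\times Q(N)}$, $H_4\in\mathbb H^{C(N)\times P(N)}$, $J_3\in\mathbb H^{S(M)\times D(M)}$, $J_4\in\mathbb H^{T(M)\times D(M)}$, $E_1,E_2\in\mathbb H^{I(N)\times K(M)}$, $E_3\in\mathbb H^{I(N)\times T(M)}$, $E_4\in\mathbb H^{P(N)\times K(M)}$, $E_9\in\mathbb H^{A(N)\times B(M)}$, $E_{10}\in\mathbb H^{C(N)\times D(M)}$ be given, and consider, for unknown tensors $X_1,X_2,X_3,Y_1,Y_2,Y_3,W$ of the fitting orders, the system $$(\ast)\quad\begin{cases}A_1X_3B_1=E_1,\quad A_2Y_3B_2=E_2,\quad A_3W=E_3,\quad WB_3=E_4,\\ A_6X_1+X_2B_7+C_3X_3D_3+C_4WD_4=E_9,\\ A_8Y_1+Y_2B_9+H_3Y_3J_3+H_4WJ_4=E_{10}.\end{cases}$$ Set $$\hat A_4=R_{A_6}C_3,\ \hat C_4=R_{A_6}C_4,\ \hat B_4=D_3L_{B_7},\ \hat D_4=D_4L_{B_7},\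 \hat P=R_{A_6}E_9L_{B_7},$$ $$\hat A_5=R_{A_8}H_3,\ \hat C_5=R_{A_8}H_4,\ \hat B_5=J_3L_{B_9},\ \hat D_5=J_4L_{B_9},\ \hat Q=R_{A_8}E_{10}L_{B_9},$$ $$C_6=\hat C_4L_{A_3},\ D_6=R_{B_3}\hat D_4,\ C_7=\hat C_5L_{A_3},\ D_7=R_{B_3}\hat D_5,$$ $$G=\hat P-\hat C_4A_3^\dagger E_3\hat D_4-\hat C_4L_{A_3}E_4B_3^\dagger\hat D_4,\quad F=\hat Q-\hat C_5A_3^\dagger E_3\hat D_5-\hat C_5L_{A_3}E_4B_3^\dagger\hat D_5,$$ $$M_1=R_{\hat A_4}C_6,\ N_1=D_6L_{\hat B_4},\ S_1=C_6L_{M_1},\quad M_2=R_{\hat A_5}C_7,\ N_2=D_7L_{\hat B_5},\ S_2=C_7L_{M_2},$$ $$A_{11}=(L_{M_1}L_{S_1}\ \ L_{M_2}L_{S_2}),\quad B_{11}=\tbinom{R_{D_6}}{R_{D_7}},$$ $$E_{11}=M_2^\dagger FD_7^\dagger+S_2^\dagger S_2C_7^\dagger FN_2^\dagger-M_1^\dagger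 GD_6^\dagger-S_1^\dagger S_1C_6^\dagger GN_1^\dagger,$$ $$\mathcal A=R_{A_{11}}L_{M_1},\ \mathcal B=R_{N_1}L_{B_{11}},\ \mathcal C=R_{A_{11}}L_{M_2},\ \mathcal D=R_{N_2}L_{B_{11}},\ \mathcal E=R_{A_{11}}E_{11}L_{B_{11}},$$ $$\mathcal M=R_{\mathcal A}\mathcal C,\ \mathcal N=\mathcal DL_{\mathcal B},\ \mathcal S=\mathcal CL_{\mathcal M},$$ $$A_{22}=(L_{A_1}\ \ L_{\hat A_4}),\ B_{22}=\tbinom{R_{B_1}}{R_{\hat B_4}},\ C_{22}=\hat A_4^\dagger S_1,\ D_{22}=R_{N_1}D_6\hat B_4^\dagger,$$ $$E_{22}=\hat A_4^\dagger G\hat B_4^\dagger-A_1^\dagger E_1B_1^\dagger-\hat A_4^\dagger S_1C_6^\dagger GN_1^\dagger D_6\hat B_4^\dagger-\hat A_4^\dagger C_6M_1^\dagger G\hat B_4^\dagger,$$ $$A_{33}=R_{A_{22}}C_{22},\ B_{33}=D_{22}L_{B_{22}},\ E_{33}=R_{A_{22}}E_{22}L_{B_{22}},$$ $$A_{44}=(L_{A_2}\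 \ L_{\hat A_5}),\ B_{44}=\tbinom{R_{B_2}}{R_{\hat B_5}},\ C_{44}=-\hat A_5^\dagger S_2,\ D_{44}=R_{N_2}D_7\hat B_5^\dagger,$$ $$E_{44}=\hat A_5^\dagger F\hat B_5^\dagger-A_2^\dagger E_2B_2^\dagger-\hat A_5^\dagger S_2C_7^\dagger FN_2^\dagger D_7\hat B_5^\dagger-\hat A_5^\dagger C_7M_2^\dagger F\hat B_5^\dagger,$$ $$A_{55}=R_{A_{44}}C_{44},\ B_{55}=D_{44}L_{B_{44}},\ E_{55}=R_{A_{44}}E_{44}L_{B_{44}},$$ $$A_{66}=(L_{\mathcal A}\ \ L_{A_{33}}),\ B_{66}=\tbinom{R_{\mathcal B}}{R_{B_{33}}},\ C_{66}=-\mathcal A^\dagger\mathcal S,\ D_{66}=R_{\mathcal N}\mathcal D\mathcal B^\dagger,$$ $$E_{66}=A_{33}^\dagger E_{33}B_{33}^\dagger-\mathcal A^\dagger\mathcal E\mathcal B^\dagger+\mathcal A^\dagger\mathcal S\mathcal C^\dagger\mathcal E\mathcal N^\dagger\mathcal D\mathcal B^\dagger+\mathcal A^\dagger\mathcal C\mathcal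 M^\dagger\mathcal E\mathcal B^\dagger,$$ $$A_{77}=R_{A_{66}}C_{66},\ B_{77}=D_{66}L_{B_{66}},\ E_{77}=R_{A_{66}}E_{66}L_{B_{66}},$$ $$A_{88}=(L_{\mathcal M}L_{\mathcal S}\ \ L_{A_{55}}),\ B_{88}=\tbinom{R_{\mathcal D}}{R_{B_{55}}},\ C_{88}=L_{\mathcal M},\ D_{88}=R_{\mathcal N},$$ $$E_{88}=A_{55}^\dagger E_{55}B_{55}^\dagger-\mathcal M^\dagger\mathcal E\mathcal D^\dagger-\mathcal S^\dagger\mathcal S\mathcal C^\dagger\mathcal E\mathcal N^\dagger,$$ $$A_{99}=R_{A_{88}}C_{88},\ B_{99}=D_{88}L_{B_{88}},\ E_{99}=R_{A_{88}}E_{88}L_{B_{88}},$$ $$\tilde A=(L_{A_{77}}\ \ -L_{A_{99}}),\ \tilde B=\tbinom{R_{B_{77}}}{-R_{B_{99}}},\ \tilde E=A_{77}^\dagger E_{77}B_{77}^\dagger-A_{99}^\dagger E_{99}B_{99}^\dagger.$$ Then $(\ast)$ is solvable if and only if $$\begin{aligned} &R_{A_3}E_3=0,\ E_4L_{B_3}=0,\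 A_3E_4=E_3B_3,\\ &R_{\hat A_4}GL_{D_6}=0,\ R_{C_6}GL_{\hat B_4}=0,\ R_{M_1}R_{\hat A_4}G=0,\ GL_{\hat B_4}L_{N_1}=0,\\ &R_{\hat A_5}FL_{D_7}=0,\ R_{C_7}FL_{\hat B_5}=0,\ R_{M_2}R_{\hat A_5}F=0,\ FL_{\hat B_5}L_{N_2}=0,\\ &R_{\mathcal M}R_{\mathcal A}\mathcal E=0,\ R_{\mathcal A}\mathcal EL_{\mathcal D}=0,\ \mathcal EL_{\mathcal B}L_{\mathcal N}=0,\ R_{\mathcal C}\mathcal EL_{\mathcal B}=0,\\ &R_{A_1}E_1=0,\ E_1L_{B_1}=0,\ R_{A_2}E_2=0,\ E_2L_{B_2}=0,\\ &R_{A_{kk}}E_{kk}=0,\ E_{kk}L_{B_{kk}}=0\ (k=3,5,7,9),\qquad R_{\tilde A}\tilde EL_{\tilde B}=0. \end{aligned}$$ Under these conditions $(X_1,X_2,X_3,Y_1,Y_2,Y_3,W)$ is a solution of $(\ast)$ if and only if there are tensors $K_i$, $W_i$ $(i=1,2,3)$, $H_{jk}$ $(1\le j\le 4,\ 1\le k\le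 3)$, $T_{31},T_{41},\hat T_{21},J_{31},J_{41},\hat J_{21}$ of the fitting orders such that $$\begin{aligned} X_1&=A_6^\dagger\grave E_1-\hat T_{21}B_7+L_{A_6}T_{41},& X_2&=R_{A_6}\grave E_1B_7^\dagger+A_6\hat T_{21}+T_{31}R_{B_7},\\ Y_1&=A_8^\dagger\grave E_2-\hat J_{21}B_9+L_{A_8}J_{41},& Y_2&=R_{A_8}\grave E_2B_9^\dagger+A_8\hat J_{21}+J_{31}R_{B_9},\\ X_3&=A_1^\dagger E_1B_1^\dagger+L_{A_1}U_1+U_2R_{B_1},& Y_3&=A_2^\dagger E_2B_2^\dagger+L_{A_2}U_3+U_4R_{B_2},\\ W&=A_3^\dagger E_3+L_{A_3}E_4B_3^\dagger+L_{A_3}U_5R_{B_3}, \end{aligned}$$ where $\grave E_1=E_9-C_3X_3D_3-C_4WD_4$, $\grave E_2=E_{10}-H_3Y_3J_3-H_4WJ_4$ and, with $(I\ \ 0)$ and $\binom I0$ having two blocks of the same order, $$\begin{aligned} U_1&=(I\ \ 0)\big(A_{22}^\dagger(E_{22}-C_{22}V_2D_{22})-A_{22}^\dagger H_{12}B_{22}+L_{A_{22}}H_{11}\big),\\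 U_2&=\big(R_{A_{22}}(E_{22}-C_{22}V_2D_{22})B_{22}^\dagger+A_{22}A_{22}^\dagger H_{12}+H_{13}R_{B_{22}}\big)\tbinom I0,\\ U_3&=(I\ \ 0)\big(A_{44}^\dagger(E_{44}-C_{44}T_2D_{44})-A_{44}^\dagger H_{22}B_{44}+L_{A_{44}}H_{21}\big),\\ U_4&=\big(R_{A_{44}}(E_{44}-C_{44}T_2D_{44})B_{44}^\dagger+A_{44}A_{44}^\dagger H_{22}+H_{23}R_{B_{44}}\big)\tbinom I0,\\ U_5&=M_1^\dagger GD_6^\dagger+S_1^\dagger S_1C_6^\dagger GN_1^\dagger+L_{M_1}L_{S_1}V_1+L_{M_1}V_2R_{N_1}+V_3R_{D_6},\\ V_1&=(I\ \ 0)\big(A_{11}^\dagger(E_{11}-L_{M_1}V_2R_{N_1}-L_{M_2}T_2R_{N_2})+W_1B_{11}+L_{A_{11}}W_2\big),\\ V_2&=\mathcal A^\dagger\mathcal E\mathcal B^\dagger-\mathcal A^\dagger\mathcal S\mathcal C^\dagger\mathcal E\mathcal N^\dagger\mathcal D\mathcal B^\dagger-\mathcal A^\dagger\mathcal C\mathcal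 M^\dagger\mathcal E\mathcal B^\dagger-\mathcal A^\dagger\mathcal SW_4R_{\mathcal N}\mathcal D\mathcal B^\dagger+L_{\mathcal A}W_5+W_6R_{\mathcal B},\\ V_3&=\big(R_{A_{11}}(E_{11}-L_{M_1}V_2R_{N_1}-L_{M_2}T_2R_{N_2})B_{11}^\dagger-A_{11}W_1-W_3R_{B_{11}}\big)\tbinom I0,\\ T_2&=\mathcal M^\dagger\mathcal E\mathcal D^\dagger+\mathcal S^\dagger\mathcal S\mathcal C^\dagger\mathcal E\mathcal N^\dagger+L_{\mathcal M}L_{\mathcal S}W_7+L_{\mathcal M}W_4R_{\mathcal N}+W_8R_{\mathcal D},\\ W_4&=A_{77}^\dagger E_{77}B_{77}^\dagger-L_{A_{77}}Q_1-Q_2R_{B_{77}},\\ W_5&=(I\ \ 0)\big(A_{66}^\dagger(E_{66}-C_{66}W_4D_{66})-A_{66}^\dagger H_{32}B_{66}+L_{A_{66}}H_{31}\big),\\ W_6&=\big(R_{A_{66}}(E_{66}-C_{66}W_4D_{66})B_{66}^\dagger+A_{66}A_{66}^\dagger H_{32}+H_{33}R_{B_{66}}\big)\tbinom I0,\\ W_7&=(I\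 \ 0)\big(A_{88}^\dagger(E_{88}-C_{88}W_4D_{88})-A_{88}^\dagger H_{42}B_{88}+L_{A_{88}}H_{41}\big),\\ W_8&=\big(R_{A_{88}}(E_{88}-C_{88}W_4D_{88})B_{88}^\dagger+A_{88}A_{88}^\dagger H_{42}+H_{43}R_{B_{88}}\big)\tbinom I0,\\ Q_1&=(I\ \ 0)\big(\tilde A^\dagger\tilde E-\tilde A^\dagger K_2\tilde B+L_{\tilde A}K_1\big),\\ Q_2&=\big(R_{\tilde A}\tilde E\tilde B^\dagger+\tilde A\tilde A^\dagger K_2+K_3R_{\tilde B}\big)\tbinom I0. \end{aligned}$$ -/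

import Mathlib

noncomputable section

/-- The multi-indices `(i₁, …, i_N)` with `i_s` running through `d s` values. -/
abbrev MultiIdx {N : ℕ} (d : Fin N → ℕ) : Type := (s : Fin N) → Fin (d s)

/-- Quaternion tensors in `ℍ^{I(N) × J(M)}`.  As functions of a pair of multi-indices they are
matrices over the multi-index sets, so that the Einstein product `(A * B) i k = ∑ j, A i j * B j k`
(the sum being over all multi-indices `j`) is the product `*`, the unit tensor is `1`, and the
conjugate transpose is `Matrix.conjTranspose`. -/
abbrev QTensor {N M : ℕ} (I : Fin N → ℕ) (J : Fin M → ℕ) : Type :=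
  Matrix (MultiIdx I) (MultiIdx J) (Quaternion ℝ)

/-- The row block tensor `(A B) ∈ ℍ^{I(N) × L(M)}`, `L_s = J_s + K_s`; all the entries outside the
two blocks are `0`. -/
def rowBlock {N M : ℕ} {I : Fin N → ℕ} {J K : Fin M → ℕ} (A : QTensor I J) (B : QTensor I K) :
    QTensor I (fun s => J s + K s) := fun i l =>
  if h : ∀ s, (l s : ℕ) < J s then A i (fun s => ⟨l s, h s⟩)
  else if h' : ∀ s, J s ≤ (l s : ℕ) then
    B i (fun s => ⟨(l s : ℕ) - J s, by have h₁ : (l s : ℕ) < J s + K s := (l s).isLt; have := h' s; omega⟩)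
  else 0

/-- The column block tensor with upper block `C` and lower block `D`, in `ℍ^{L(M) × I(N)}`,
`L_s = J_s + K_s`; all the entries outside the two blocks are `0`. -/
def colBlock {N M : ℕ} {I : Fin N → ℕ} {J K : Fin M → ℕ} (C : QTensor J I) (D : QTensor K I) :
    QTensor (fun s => J s + K s) I := fun l i =>
  if h : ∀ s, (l s : ℕ) < J s then C (fun s => ⟨l s, h s⟩) i
  else if h' : ∀ s, J s ≤ (l s : ℕ) then
    D (fun s => ⟨(l s : ℕ) - J s, by have h₁ : (l s : ℕ) < J s + K s := (l s).isLt; have := h' s; omega⟩) i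
  else 0

/-- The four Penrose equations: `X` is a Moore–Penrose inverse of `A`. -/
def IsMoorePenrose {m n : Type} [Fintype m] [Fintype n]
    (A : Matrix m n (Quaternion ℝ)) (X : Matrix n m (Quaternion ℝ)) : Prop :=
  A * X * A = A ∧ X * A * X = X ∧ (A * X).conjTranspose = A * X ∧ (X * A).conjTranspose = X * A

theorem exists_inner_inverse {m n : Type} [Fintype m] [Fintype n]
    (A : Matrix m n (Quaternion ℝ)) : ∃ G : Matrix n m (Quaternion ℝ), A * G * A = A := by
  classical
  let f := Matrix.toLinearMapRight' A
  obtain ⟨g₁, hg₁⟩ := f.rangeRestrict.exists_rightInverse_of_surjective f.range_rangeRestrict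
  obtain ⟨g₂, hg₂⟩ := f.range.subtype.exists_leftInverse_of_injective f.range.ker_subtype
  have key : f ∘ₗ (g₁ ∘ₗ g₂) ∘ₗ f = f := by
    refine LinearMap.ext fun x => ?_
    have h1 : g₂ (f x) = f.rangeRestrict x := LinearMap.congr_fun hg₂ (f.rangeRestrict x)
    have h2 := LinearMap.congr_fun hg₁ (f.rangeRestrict x)
    have h3 := congrArg Subtype.val h2
    simp only [LinearMap.comp_apply, h1]
    exact h3
  refine ⟨LinearMap.toMatrixRight' (g₁ ∘ₗ g₂), ?_⟩
  apply Matrix.toLinearMapRight'.injective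
  rw [Matrix.toLinearMapRight'_mul, Matrix.toLinearMapRight'_mul]
  simpa using key

theorem eq_zero_of_conjTranspose_mul_self {m n : Type} [Fintype m]
    {A : Matrix m n (Quaternion ℝ)} (h : A.conjTranspose * A = 0) : A = 0 := by
  ext1 i j
  have h1 : ∑ k, star (A k j) * A k j = 0 := by
    simpa [Matrix.mul_apply] using congrFun (congrFun h j) j
  have h2 : ∑ k, Quaternion.normSq (A k j) = 0 := by
    have : ((∑ k, Quaternion.normSq (A k j) : ℝ) : Quaternion ℝ) = 0 := by
      rw [← h1, show ((∑ k, Quaternion.normSq (A k j) : ℝ) : Quaternion ℝ)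
        = ∑ k, ((Quaternion.normSq (A k j) : ℝ) : Quaternion ℝ) from
          map_sum (algebraMap ℝ (Quaternion ℝ)) _ _]
      exact Finset.sum_congr rfl fun k _ => (Quaternion.star_mul_self (A k j)).symm
    exact Quaternion.coe_injective (this.trans Quaternion.coe_zero.symm)
  have h3 := (Finset.sum_eq_zero_iff_of_nonneg fun k _ => Quaternion.normSq_nonneg).1 h2 i
    (Finset.mem_univ i)
  simpa using h3

theorem exists_one_three_inverse {m n : Type} [Fintype m] [Fintype n]
    (A : Matrix m n (Quaternion ℝ)) :
    ∃ X : Matrix n m (Quaternion ℝ), A * X * A = A ∧ (A * X).conjTranspose = A * X := by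
  classical
  obtain ⟨G, hG⟩ := exists_inner_inverse (A.conjTranspose * A)
  have h0 : A * G * (A.conjTranspose * A) - A = 0 := by
    apply eq_zero_of_conjTranspose_mul_self
    have e : A.conjTranspose * (A * G * (A.conjTranspose * A) - A) = 0 := by
      rw [Matrix.mul_sub, sub_eq_zero, ← hG]
      simp only [Matrix.mul_assoc] at hG ⊢
      simp only [hG]
    have e2 : (A * G * (A.conjTranspose * A) - A).conjTranspose
        = (G * (A.conjTranspose * A) - 1).conjTranspose * A.conjTranspose := by
      rw [← Matrix.conjTranspose_mul, Matrix.mul_sub, Matrix.mul_one, Matrix.mul_assoc]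
    rw [e2, Matrix.mul_assoc, e, Matrix.mul_zero]
  have h1 : A * G * (A.conjTranspose * A) = A := sub_eq_zero.1 h0
  have h1' : A * (G * A.conjTranspose) * A = A := by
    simpa only [Matrix.mul_assoc] using h1
  refine ⟨G * A.conjTranspose, h1', ?_⟩
  set P := A * (G * A.conjTranspose) with hP
  have hPs : P.conjTranspose = A * (G.conjTranspose * A.conjTranspose) := by
    rw [hP]; simp [Matrix.mul_assoc]
  have h2 : P * P.conjTranspose = P.conjTranspose := by
    rw [hPs, ← Matrix.mul_assoc P A, h1']
  have h3 := congrArg Matrix.conjTranspose h2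
  rw [Matrix.conjTranspose_mul, Matrix.conjTranspose_conjTranspose, h2] at h3
  exact h3

/-- Every quaternion matrix has a Moore–Penrose inverse. -/
theorem exists_isMoorePenrose {m n : Type} [Fintype m] [Fintype n]
    (A : Matrix m n (Quaternion ℝ)) : ∃ X, IsMoorePenrose A X := by
  obtain ⟨X, hX1, hX3⟩ := exists_one_three_inverse A
  obtain ⟨Z, hZ1, hZ3⟩ := exists_one_three_inverse A.conjTranspose
  have hY1 : A * Z.conjTranspose * A = A := by
    have := congrArg Matrix.conjTranspose hZ1
    simpa [Matrix.mul_assoc] using this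
  have hY4 : (Z.conjTranspose * A).conjTranspose = Z.conjTranspose * A := by
    have := congrArg Matrix.conjTranspose hZ3
    rw [hZ3, Matrix.conjTranspose_mul, Matrix.conjTranspose_conjTranspose] at this
    rw [Matrix.conjTranspose_mul, Matrix.conjTranspose_conjTranspose, this]
  have hAX : A * (Z.conjTranspose * A * X) = A * X := by
    rw [← Matrix.mul_assoc, ← Matrix.mul_assoc, hY1]
  have hXA : Z.conjTranspose * A * X * A = Z.conjTranspose * A := by
    rw [Matrix.mul_assoc, Matrix.mul_assoc, ← Matrix.mul_assoc A, hX1]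
  refine ⟨Z.conjTranspose * A * X, ?_, ?_, ?_, ?_⟩
  · rw [hAX, hX1]
  · rw [hXA, Matrix.mul_assoc, hAX, Matrix.mul_assoc]
  · rw [hAX, hX3]
  · rw [hXA, hY4]

/-- The Moore–Penrose inverse is unique. -/
theorem IsMoorePenrose.unique {m n : Type} [Fintype m] [Fintype n]
    {A : Matrix m n (Quaternion ℝ)} {X Y : Matrix n m (Quaternion ℝ)}
    (hX : IsMoorePenrose A X) (hY : IsMoorePenrose A Y) : X = Y := by
  obtain ⟨x1, x2, x3, x4⟩ := hX
  obtain ⟨y1, y2, y3, y4⟩ := hY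
  have a : A * X = A * Y := by
    calc A * X = (A * X).conjTranspose := x3.symm
      _ = ((A * Y) * (A * X)).conjTranspose := by rw [← Matrix.mul_assoc, y1]
      _ = (A * X) * (A * Y) := by rw [Matrix.conjTranspose_mul, x3, y3]
      _ = A * Y := by rw [← Matrix.mul_assoc, x1]
  have b : X * A = Y * A := by
    calc X * A = (X * A).conjTranspose := x4.symm
      _ = ((X * A) * (Y * A)).conjTranspose := by
          rw [Matrix.mul_assoc, ← Matrix.mul_assoc A, y1]
      _ = (Y * A) * (X * A) := by rw [Matrix.conjTranspose_mul, x4, y4]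
      _ = Y * A := by rw [Matrix.mul_assoc, ← Matrix.mul_assoc A, x1]
  calc X = X * A * X := x2.symm
    _ = Y * A * Y := by rw [b, Matrix.mul_assoc, a, ← Matrix.mul_assoc]
    _ = Y := y2

/-- The Moore–Penrose inverse `D†` of a quaternion tensor `D`. -/
def mpInv {N M : ℕ} {I : Fin N → ℕ} {J : Fin M → ℕ} (D : QTensor I J) : QTensor J I :=
  Classical.choose (exists_isMoorePenrose D)

postfix:max "†" => mpInv

/-- `D†` satisfies the four Penrose equations. -/
theorem mpInv_spec {N M : ℕ} {I : Fin N → ℕ} {J : Fin M → ℕ} (D : QTensor I J) :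
    IsMoorePenrose D D† :=
  Classical.choose_spec (exists_isMoorePenrose D)

/-- `R_D = I - D D†`. -/
def projR {N M : ℕ} {I : Fin N → ℕ} {J : Fin M → ℕ} (D : QTensor I J) : QTensor I I :=
  1 - D * D†

/-- `L_D = I - D† D`. -/
def projL {N M : ℕ} {I : Fin N → ℕ} {J : Fin M → ℕ} (D : QTensor I J) : QTensor J J :=
  1 - D† * D

/-- The row block tensor `(I 0)` with blocks of the same order: it selects the upper block. -/
def selTop {N : ℕ} (J : Fin N → ℕ) : QTensor J (fun s => J s + J s) :=
  rowBlock (1 : QTensor J J) (0 : QTensor J J)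

/-- The column block tensor with upper block `I` and lower block `0`, of the same order: it selects
the left block. -/
def selLeft {N : ℕ} (J : Fin N → ℕ) : QTensor (fun s => J s + J s) J :=
  colBlock (1 : QTensor J J) (0 : QTensor J J)

/-- The given tensors of the system
`A₁ X₃ B₁ = E₁`, `A₂ Y₃ B₂ = E₂`, `A₃ W = E₃`, `W B₃ = E₄`,
`A₆ X₁ + X₂ B₇ + C₃ X₃ D₃ + C₄ W D₄ = E₉`, `A₈ Y₁ + Y₂ B₉ + H₃ Y₃ J₃ + H₄ W J₄ = E₁₀`. -/
structure SylvesterData {N M : ℕ} (dI dJ dQ dP dA dE dC dR : Fin N → ℕ)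
    (dL dK dS dT dH dB dO dD : Fin M → ℕ) where
  A1 : QTensor dI dJ
  A2 : QTensor dI dQ
  A3 : QTensor dI dP
  A6 : QTensor dA dE
  A8 : QTensor dC dR
  B1 : QTensor dL dK
  B2 : QTensor dS dK
  B3 : QTensor dT dK
  B7 : QTensor dH dB
  B9 : QTensor dO dD
  C3 : QTensor dA dJ
  C4 : QTensor dA dP
  D3 : QTensor dL dB
  D4 : QTensor dT dB
  H3 : QTensor dC dQ
  H4 : QTensor dC dP
  J3 : QTensor dS dD
  J4 : QTensor dT dD
  E1 : QTensor dI dK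
  E2 : QTensor dI dK
  E3 : QTensor dI dT
  E4 : QTensor dP dK
  E9 : QTensor dA dB
  E10 : QTensor dC dD

/-- The arbitrary tensors on which the general solution depends. -/
structure FreeTensors {N M : ℕ} (dJ dQ dP dA dE dC dR : Fin N → ℕ)
    (dL dS dT dH dB dO dD : Fin M → ℕ) where
  K1 : QTensor (fun s => dP s + dP s) dT
  K2 : QTensor dP (fun s => dT s + dT s)
  K3 : QTensor dP (fun s => dT s + dT s)
  W1 : QTensor (fun s => dP s + dP s) (fun s => dT s + dT s)
  W2 : QTensor (fun s => dP s + dP s) dT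
  W3 : QTensor dP (fun s => dT s + dT s)
  H11 : QTensor (fun s => dJ s + dJ s) dL
  H12 : QTensor dJ (fun s => dL s + dL s)
  H13 : QTensor dJ (fun s => dL s + dL s)
  H21 : QTensor (fun s => dQ s + dQ s) dS
  H22 : QTensor dQ (fun s => dS s + dS s)
  H23 : QTensor dQ (fun s => dS s + dS s)
  H31 : QTensor (fun s => dP s + dP s) dT
  H32 : QTensor dP (fun s => dT s + dT s)
  H33 : QTensor dP (fun s => dT s + dT s)
  H41 : QTensor (fun s => dP s + dP s) dT
  H42 : QTensor dP (fun s => dT s + dT s)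
  H43 : QTensor dP (fun s => dT s + dT s)
  T21 : QTensor dE dH
  T31 : QTensor dA dH
  T41 : QTensor dE dB
  J21 : QTensor dR dO
  J31 : QTensor dC dO
  J41 : QTensor dR dD

namespace SylvesterData

variable {N M : ℕ} {dI dJ dQ dP dA dE dC dR : Fin N → ℕ} {dL dK dS dT dH dB dO dD : Fin M → ℕ}
  (s : SylvesterData dI dJ dQ dP dA dE dC dR dL dK dS dT dH dB dO dD)

/-- `(X₁, X₂, X₃, Y₁, Y₂, Y₃, W)` solves the system. -/
def IsSolution (X1 : QTensor dE dB) (X2 : QTensor dA dH) (X3 : QTensor dJ dL)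
    (Y1 : QTensor dR dD) (Y2 : QTensor dC dO) (Y3 : QTensor dQ dS) (W : QTensor dP dT) : Prop :=
  s.A1 * X3 * s.B1 = s.E1 ∧ s.A2 * Y3 * s.B2 = s.E2 ∧
  s.A3 * W = s.E3 ∧ W * s.B3 = s.E4 ∧
  s.A6 * X1 + X2 * s.B7 + s.C3 * X3 * s.D3 + s.C4 * W * s.D4 = s.E9 ∧
  s.A8 * Y1 + Y2 * s.B9 + s.H3 * Y3 * s.J3 + s.H4 * W * s.J4 = s.E10

/-! The auxiliary tensors. Letters with a hat carry the suffix `h`, the letters without an index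
carry the prefix `cal`, and those with a tilde the suffix `t`. -/

def A4h : QTensor dA dJ := projR s.A6 * s.C3
def C4h : QTensor dA dP := projR s.A6 * s.C4
def B4h : QTensor dL dB := s.D3 * projL s.B7
def D4h : QTensor dT dB := s.D4 * projL s.B7
def Ph : QTensor dA dB := projR s.A6 * s.E9 * projL s.B7
def A5h : QTensor dC dQ := projR s.A8 * s.H3
def C5h : QTensor dC dP := projR s.A8 * s.H4
def B5h : QTensor dS dD := s.J3 * projL s.B9
def D5h : QTensor dT dD := s.J4 * projL s.B9
def Qh : QTensor dC dD := projR s.A8 * s.E10 * projL s.B9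

def C6 : QTensor dA dP := s.C4h * projL s.A3
def D6 : QTensor dT dB := projR s.B3 * s.D4h
def C7 : QTensor dC dP := s.C5h * projL s.A3
def D7 : QTensor dT dD := projR s.B3 * s.D5h

def calG : QTensor dA dB :=
  s.Ph - s.C4h * s.A3† * s.E3 * s.D4h - s.C4h * projL s.A3 * s.E4 * s.B3† * s.D4h
def calF : QTensor dC dD :=
  s.Qh - s.C5h * s.A3† * s.E3 * s.D5h - s.C5h * projL s.A3 * s.E4 * s.B3† * s.D5h

def M1 : QTensor dA dP := projR s.A4h * s.C6
def N1 : QTensor dT dB := s.D6 * projL s.B4h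
def S1 : QTensor dA dP := s.C6 * projL s.M1
def M2 : QTensor dC dP := projR s.A5h * s.C7
def N2 : QTensor dT dD := s.D7 * projL s.B5h
def S2 : QTensor dC dP := s.C7 * projL s.M2

def A11 : QTensor dP (fun s => dP s + dP s) :=
  rowBlock (projL s.M1 * projL s.S1) (projL s.M2 * projL s.S2)
def B11 : QTensor (fun s => dT s + dT s) dT := colBlock (projR s.D6) (projR s.D7)
def E11 : QTensor dP dT :=
  s.M2† * s.calF * s.D7† + s.S2† * s.S2 * s.C7† * s.calF * s.N2†
    - s.M1† * s.calG * s.D6† - s.S1† * s.S1 * s.C6† * s.calG * s.N1†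

def calA : QTensor dP dP := projR s.A11 * projL s.M1
def calB : QTensor dT dT := projR s.N1 * projL s.B11
def calC : QTensor dP dP := projR s.A11 * projL s.M2
def calD : QTensor dT dT := projR s.N2 * projL s.B11
def calE : QTensor dP dT := projR s.A11 * s.E11 * projL s.B11
def calM : QTensor dP dP := projR s.calA * s.calC
def calN : QTensor dT dT := s.calD * projL s.calB
def calS : QTensor dP dP := s.calC * projL s.calM

def A22 : QTensor dJ (fun s => dJ s + dJ s) := rowBlock (projL s.A1) (projL s.A4h)
def B22 : QTensor (fun s => dL s + dL s) dL := colBlock (projR s.B1) (projR s.B4h)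
def C22 : QTensor dJ dP := s.A4h† * s.S1
def D22 : QTensor dT dL := projR s.N1 * s.D6 * s.B4h†
def E22 : QTensor dJ dL :=
  s.A4h† * s.calG * s.B4h† - s.A1† * s.E1 * s.B1†
    - s.A4h† * s.S1 * s.C6† * s.calG * s.N1† * s.D6 * s.B4h†
    - s.A4h† * s.C6 * s.M1† * s.calG * s.B4h†
def A33 : QTensor dJ dP := projR s.A22 * s.C22
def B33 : QTensor dT dL := s.D22 * projL s.B22
def E33 : QTensor dJ dL := projR s.A22 * s.E22 * projL s.B22

def A44 : QTensor dQ (fun s => dQ s + dQ s) := rowBlock (projL s.A2) (projL s.A5h)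
def B44 : QTensor (fun s => dS s + dS s) dS := colBlock (projR s.B2) (projR s.B5h)
def C44 : QTensor dQ dP := -(s.A5h† * s.S2)
def D44 : QTensor dT dS := projR s.N2 * s.D7 * s.B5h†
def E44 : QTensor dQ dS :=
  s.A5h† * s.calF * s.B5h† - s.A2† * s.E2 * s.B2†
    - s.A5h† * s.S2 * s.C7† * s.calF * s.N2† * s.D7 * s.B5h†
    - s.A5h† * s.C7 * s.M2† * s.calF * s.B5h†
def A55 : QTensor dQ dP := projR s.A44 * s.C44
def B55 : QTensor dT dS := s.D44 * projL s.B44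
def E55 : QTensor dQ dS := projR s.A44 * s.E44 * projL s.B44

def A66 : QTensor dP (fun s => dP s + dP s) := rowBlock (projL s.calA) (projL s.A33)
def B66 : QTensor (fun s => dT s + dT s) dT := colBlock (projR s.calB) (projR s.B33)
def C66 : QTensor dP dP := -(s.calA† * s.calS)
def D66 : QTensor dT dT := projR s.calN * s.calD * s.calB†
def E66 : QTensor dP dT :=
  s.A33† * s.E33 * s.B33† - s.calA† * s.calE * s.calB†
    + s.calA† * s.calS * s.calC† * s.calE * s.calN† * s.calD * s.calB†
    + s.calA† * s.calC * s.calM† * s.calE * s.calB†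
def A77 : QTensor dP dP := projR s.A66 * s.C66
def B77 : QTensor dT dT := s.D66 * projL s.B66
def E77 : QTensor dP dT := projR s.A66 * s.E66 * projL s.B66

def A88 : QTensor dP (fun s => dP s + dP s) :=
  rowBlock (projL s.calM * projL s.calS) (projL s.A55)
def B88 : QTensor (fun s => dT s + dT s) dT := colBlock (projR s.calD) (projR s.B55)
def C88 : QTensor dP dP := projL s.calM
def D88 : QTensor dT dT := projR s.calN
def E88 : QTensor dP dT :=
  s.A55† * s.E55 * s.B55† - s.calM† * s.calE * s.calD†
    - s.calS† * s.calS * s.calC† * s.calE * s.calN†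
def A99 : QTensor dP dP := projR s.A88 * s.C88
def B99 : QTensor dT dT := s.D88 * projL s.B88
def E99 : QTensor dP dT := projR s.A88 * s.E88 * projL s.B88

def At : QTensor dP (fun s => dP s + dP s) := rowBlock (projL s.A77) (-projL s.A99)
def Bt : QTensor (fun s => dT s + dT s) dT := colBlock (projR s.B77) (-projR s.B99)
def Et : QTensor dP dT := s.A77† * s.E77 * s.B77† - s.A99† * s.E99 * s.B99†

/-- The solvability conditions. -/
def SolvabilityConditions : Prop :=
  projR s.A3 * s.E3 = 0 ∧ s.E4 * projL s.B3 = 0 ∧ s.A3 * s.E4 = s.E3 * s.B3 ∧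
  projR s.A4h * s.calG * projL s.D6 = 0 ∧ projR s.C6 * s.calG * projL s.B4h = 0 ∧
  projR s.M1 * projR s.A4h * s.calG = 0 ∧ s.calG * projL s.B4h * projL s.N1 = 0 ∧
  projR s.A5h * s.calF * projL s.D7 = 0 ∧ projR s.C7 * s.calF * projL s.B5h = 0 ∧
  projR s.M2 * projR s.A5h * s.calF = 0 ∧ s.calF * projL s.B5h * projL s.N2 = 0 ∧
  projR s.calM * projR s.calA * s.calE = 0 ∧ projR s.calA * s.calE * projL s.calD = 0 ∧
  s.calE * projL s.calB * projL s.calN = 0 ∧ projR s.calC * s.calE * projL s.calB = 0 ∧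
  projR s.A1 * s.E1 = 0 ∧ s.E1 * projL s.B1 = 0 ∧
  projR s.A2 * s.E2 = 0 ∧ s.E2 * projL s.B2 = 0 ∧
  projR s.A33 * s.E33 = 0 ∧ s.E33 * projL s.B33 = 0 ∧
  projR s.A55 * s.E55 = 0 ∧ s.E55 * projL s.B55 = 0 ∧
  projR s.A77 * s.E77 = 0 ∧ s.E77 * projL s.B77 = 0 ∧
  projR s.A99 * s.E99 = 0 ∧ s.E99 * projL s.B99 = 0 ∧
  projR s.At * s.Et * projL s.Bt = 0

/-! The general solution, as a function of the arbitrary tensors. -/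

variable (p : FreeTensors dJ dQ dP dA dE dC dR dL dS dT dH dB dO dD)

def solQ1 : QTensor dP dT :=
  selTop dP * (s.At† * s.Et - s.At† * p.K2 * s.Bt + projL s.At * p.K1)
def solQ2 : QTensor dP dT :=
  (projR s.At * s.Et * s.Bt† + s.At * s.At† * p.K2 + p.K3 * projR s.Bt) * selLeft dT

def solW4 : QTensor dP dT :=
  s.A77† * s.E77 * s.B77† - projL s.A77 * s.solQ1 p - s.solQ2 p * projR s.B77

def solW5 : QTensor dP dT :=
  selTop dP * (s.A66† * (s.E66 - s.C66 * s.solW4 p * s.D66) - s.A66† * p.H32 * s.B66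
    + projL s.A66 * p.H31)
def solW6 : QTensor dP dT :=
  (projR s.A66 * (s.E66 - s.C66 * s.solW4 p * s.D66) * s.B66† + s.A66 * s.A66† * p.H32
    + p.H33 * projR s.B66) * selLeft dT
def solW7 : QTensor dP dT :=
  selTop dP * (s.A88† * (s.E88 - s.C88 * s.solW4 p * s.D88) - s.A88† * p.H42 * s.B88
    + projL s.A88 * p.H41)
def solW8 : QTensor dP dT :=
  (projR s.A88 * (s.E88 - s.C88 * s.solW4 p * s.D88) * s.B88† + s.A88 * s.A88† * p.H42
    + p.H43 * projR s.B88) * selLeft dT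

def solV2 : QTensor dP dT :=
  s.calA† * s.calE * s.calB†
    - s.calA† * s.calS * s.calC† * s.calE * s.calN† * s.calD * s.calB†
    - s.calA† * s.calC * s.calM† * s.calE * s.calB†
    - s.calA† * s.calS * s.solW4 p * projR s.calN * s.calD * s.calB†
    + projL s.calA * s.solW5 p + s.solW6 p * projR s.calB
def solT2 : QTensor dP dT :=
  s.calM† * s.calE * s.calD† + s.calS† * s.calS * s.calC† * s.calE * s.calN†
    + projL s.calM * projL s.calS * s.solW7 p + projL s.calM * s.solW4 p * projR s.calN
    + s.solW8 p * projR s.calD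

def solV1 : QTensor dP dT :=
  selTop dP * (s.A11† * (s.E11 - projL s.M1 * s.solV2 p * projR s.N1
      - projL s.M2 * s.solT2 p * projR s.N2)
    + p.W1 * s.B11 + projL s.A11 * p.W2)
def solV3 : QTensor dP dT :=
  (projR s.A11 * (s.E11 - projL s.M1 * s.solV2 p * projR s.N1
      - projL s.M2 * s.solT2 p * projR s.N2) * s.B11†
    - s.A11 * p.W1 - p.W3 * projR s.B11) * selLeft dT

def solU1 : QTensor dJ dL :=
  selTop dJ * (s.A22† * (s.E22 - s.C22 * s.solV2 p * s.D22) - s.A22† * p.H12 * s.B22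
    + projL s.A22 * p.H11)
def solU2 : QTensor dJ dL :=
  (projR s.A22 * (s.E22 - s.C22 * s.solV2 p * s.D22) * s.B22† + s.A22 * s.A22† * p.H12
    + p.H13 * projR s.B22) * selLeft dL
def solU3 : QTensor dQ dS :=
  selTop dQ * (s.A44† * (s.E44 - s.C44 * s.solT2 p * s.D44) - s.A44† * p.H22 * s.B44
    + projL s.A44 * p.H21)
def solU4 : QTensor dQ dS :=
  (projR s.A44 * (s.E44 - s.C44 * s.solT2 p * s.D44) * s.B44† + s.A44 * s.A44† * p.H22
    + p.H23 * projR s.B44) * selLeft dS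
def solU5 : QTensor dP dT :=
  s.M1† * s.calG * s.D6† + s.S1† * s.S1 * s.C6† * s.calG * s.N1†
    + projL s.M1 * projL s.S1 * s.solV1 p + projL s.M1 * s.solV2 p * projR s.N1
    + s.solV3 p * projR s.D6

def solX3 : QTensor dJ dL :=
  s.A1† * s.E1 * s.B1† + projL s.A1 * s.solU1 p + s.solU2 p * projR s.B1
def solY3 : QTensor dQ dS :=
  s.A2† * s.E2 * s.B2† + projL s.A2 * s.solU3 p + s.solU4 p * projR s.B2
def solW : QTensor dP dT :=
  s.A3† * s.E3 + projL s.A3 * s.E4 * s.B3† + projL s.A3 * s.solU5 p * projR s.B3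

/-- `È₁ = E₉ - C₃ X₃ D₃ - C₄ W D₄`. -/
def solE1 : QTensor dA dB := s.E9 - s.C3 * s.solX3 p * s.D3 - s.C4 * s.solW p * s.D4
/-- `È₂ = E₁₀ - H₃ Y₃ J₃ - H₄ W J₄`. -/
def solE2 : QTensor dC dD := s.E10 - s.H3 * s.solY3 p * s.J3 - s.H4 * s.solW p * s.J4

def solX1 : QTensor dE dB := s.A6† * s.solE1 p - p.T21 * s.B7 + projL s.A6 * p.T41
def solX2 : QTensor dA dH :=
  projR s.A6 * s.solE1 p * s.B7† + s.A6 * p.T21 + p.T31 * projR s.B7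
def solY1 : QTensor dR dD := s.A8† * s.solE2 p - p.J21 * s.B9 + projL s.A8 * p.J41
def solY2 : QTensor dC dO :=
  projR s.A8 * s.solE2 p * s.B9† + s.A8 * p.J21 + p.J31 * projR s.B9

end SylvesterData

end

/-! The system is solved by elimination, and each elimination step is an equivalence between an
equation and a pair: a consistency condition together with a parametrization of all solutions. The
building blocks are the equations `A X = C, X B = D` (`mul_eq_and_mul_eq_iff`), `A X B = C`
(`mul_mul_eq_iff`), `A X + Y B = C` (`mul_add_mul_eq_iff` and a variant) and, as the main tool, `A X
B + C Y D = E` (`mul_mul_add_mul_mul_eq_iff`).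

The first four equations express `X3`, `Y3`, `W` through `U1`, ..., `U5`. Each Sylvester equation
can be solved for its two outer unknowns exactly when its compression by `projR` and `projL` holds;
after substituting `W`, these compressions become one equation in `X3`, `U5` with right side `calG`
and one in `Y3`, `U5` with right side `calF`. Solving them gives a second expression for `X3` and
for `Y3`, and two expressions for `U5`.

Equating two expressions for the same tensor gives `A U + B U' + V C + V' D = E`. Putting the
unknowns into blocks turns it into `A X + Y B = C` (`exists_add_eq_iff`). Its consistency condition
is a smaller equation in the remaining parameters: `U5` yields `calA V2 calB + calC T2 calD = calE`,
while `X3` and `Y3` yield one equation for `V2` and one for `T2`. A second round solves the former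
equation and substitutes into the other two; only the shared parameter `W4` survives, subject to
`A77 W4 B77 = E77` and `A99 W4 B99 = E99`. Equating the two general solutions for `W4` gives the
last condition, in `At`, `Bt`, `Et`. -/

open Matrix

/-! ### Moore–Penrose calculus and the basic linear equations -/

section MoorePenrose

variable {a b c d e f : ℕ} {I : Fin a → ℕ} {J : Fin b → ℕ} {K : Fin c → ℕ} {L : Fin d → ℕ}
  {P : Fin e → ℕ} {Q : Fin f → ℕ}

theorem mul_mpInv_mul (A : QTensor I J) : A * (A† * A) = A := by
  rw [← Matrix.mul_assoc]; exact (mpInv_spec A).1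

theorem mpInv_mul_mpInv (A : QTensor I J) : A† * (A * A†) = A† := by
  rw [← Matrix.mul_assoc]; exact (mpInv_spec A).2.1

theorem mul_mpInv_mul_assoc (A : QTensor I J) (Z : QTensor J K) : A * (A† * (A * Z)) = A * Z := by
  simp only [← Matrix.mul_assoc]; rw [(mpInv_spec A).1]

theorem projR_mul (A : QTensor I J) (Z : QTensor I K) : projR A * Z = Z - A * (A† * Z) := by
  rw [projR, Matrix.sub_mul, Matrix.one_mul, Matrix.mul_assoc]

theorem projL_mul (A : QTensor I J) (Z : QTensor J K) : projL A * Z = Z - A† * (A * Z) := by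
  rw [projL, Matrix.sub_mul, Matrix.one_mul, Matrix.mul_assoc]

theorem mul_projR (A : QTensor I J) (Z : QTensor K I) : Z * projR A = Z - Z * (A * A†) := by
  rw [projR, Matrix.mul_sub, Matrix.mul_one]

theorem mul_projL (A : QTensor I J) (Z : QTensor K J) : Z * projL A = Z - Z * (A† * A) := by
  rw [projL, Matrix.mul_sub, Matrix.mul_one]

theorem projR_mul_self (A : QTensor I J) : projR A * A = 0 := by
  rw [projR_mul, mul_mpInv_mul, sub_self]

theorem mul_projL_self (A : QTensor I J) : A * projL A = 0 := by
  rw [mul_projL, mul_mpInv_mul, sub_self]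

theorem projR_mul_self_assoc (A : QTensor I J) (Z : QTensor J K) : projR A * (A * Z) = 0 := by
  rw [← Matrix.mul_assoc, projR_mul_self, Matrix.zero_mul]

theorem mul_projL_self_assoc (A : QTensor I J) (Z : QTensor J K) : A * (projL A * Z) = 0 := by
  rw [← Matrix.mul_assoc, mul_projL_self, Matrix.zero_mul]

theorem conjTranspose_projR (A : QTensor I J) : (projR A)ᴴ = projR A := by
  rw [projR, conjTranspose_sub, conjTranspose_one, (mpInv_spec A).2.2.1]

theorem conjTranspose_projL (A : QTensor I J) : (projL A)ᴴ = projL A := by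
  rw [projL, conjTranspose_sub, conjTranspose_one, (mpInv_spec A).2.2.2]

/-- Taking adjoints in `T A A† = A A†` gives `A A† T = A A†`, and `A† = A† A A†` does the rest. This
lets the inverses of `projR A * C`, `D * projL B` and the like absorb the projection. -/
theorem mpInv_mul_of_mul_eq {A : QTensor I J} {T : QTensor I I} (hT : Tᴴ = T) (h : T * A = A) :
    A† * T = A† := by
  have h1 : A * A† * T = A * A† := by
    have := congrArg conjTranspose (congrArg (· * A†) h)
    simp only [Matrix.mul_assoc] at this
    rwa [conjTranspose_mul, (mpInv_spec A).2.2.1, hT] at this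
  rw [← (mpInv_spec A).2.1, Matrix.mul_assoc, Matrix.mul_assoc, ← Matrix.mul_assoc A, h1,
    Matrix.mul_assoc]

theorem mul_mpInv_of_mul_eq {A : QTensor I J} {T : QTensor J J} (hT : Tᴴ = T) (h : A * T = A) :
    T * A† = A† := by
  have h1 : T * (A† * A) = A† * A := by
    have := congrArg conjTranspose (congrArg (A† * ·) h)
    simp only [← Matrix.mul_assoc] at this
    rwa [conjTranspose_mul, (mpInv_spec A).2.2.2, hT] at this
  rw [← (mpInv_spec A).2.1, ← Matrix.mul_assoc, h1]

theorem projR_mul_projR (A : QTensor I J) : projR A * projR A = projR A := by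
  rw [projR_mul, projR, Matrix.mul_sub, Matrix.mul_one, mpInv_mul_mpInv, sub_self,
    Matrix.mul_zero, sub_zero]

theorem projL_mul_projL (A : QTensor I J) : projL A * projL A = projL A := by
  rw [projL_mul, projL, Matrix.mul_sub, Matrix.mul_one, mul_mpInv_mul, sub_self,
    Matrix.mul_zero, sub_zero]

/-- The general solution of `A X = C`, `X B = D`. -/
theorem mul_eq_and_mul_eq_iff (A : QTensor I J) (B : QTensor K L) (C : QTensor I K)
    (D : QTensor J L) (X : QTensor J K) :
    (A * X = C ∧ X * B = D) ↔
      (projR A * C = 0 ∧ D * projL B = 0 ∧ A * D = C * B) ∧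
        ∃ U : QTensor J K, X = A† * C + projL A * D * B† + projL A * U * projR B := by
  constructor
  · rintro ⟨rfl, rfl⟩
    -- The solution is its own parameter: `X = A† A X + L_A X B B† + L_A X R_B`.
    refine ⟨⟨projR_mul_self_assoc _ _, ?_, by rw [Matrix.mul_assoc]⟩, X, ?_⟩
    · rw [Matrix.mul_assoc, mul_projL_self, Matrix.mul_zero]
    · simp only [Matrix.mul_assoc, projL_mul, mul_projR, Matrix.sub_mul, Matrix.mul_sub]
      abel
  · rintro ⟨⟨h1, h2, h3⟩, U, rfl⟩
    rw [projR_mul, sub_eq_zero] at h1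
    rw [mul_projL, sub_eq_zero] at h2
    constructor
    · simp only [Matrix.mul_assoc, Matrix.mul_add, mul_projL_self_assoc, add_zero, ← h1]
    · simp only [Matrix.mul_assoc, Matrix.add_mul, projR_mul_self, Matrix.mul_zero, add_zero, ← h2]
      rw [projL_mul, h3]
      abel

/-- The general solution of `A X B = C`. -/
theorem mul_mul_eq_iff (A : QTensor I J) (B : QTensor K L) (C : QTensor I L) (X : QTensor J K) :
    A * X * B = C ↔
      (projR A * C = 0 ∧ C * projL B = 0) ∧
        ∃ U V : QTensor J K, X = A† * C * B† + projL A * U + V * projR B := by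
  constructor
  · rintro rfl
    -- These parameters come from `X = A† A X B B† + L_A X + A† A X R_B`.
    refine ⟨⟨?_, ?_⟩, X, A† * A * X, ?_⟩
    · rw [Matrix.mul_assoc, projR_mul_self_assoc]
    · rw [Matrix.mul_assoc, mul_projL_self, Matrix.mul_zero]
    · simp only [Matrix.mul_assoc, projL_mul, mul_projR, Matrix.mul_sub]
      abel
  · rintro ⟨⟨h1, h2⟩, U, V, rfl⟩
    rw [projR_mul, sub_eq_zero] at h1
    rw [mul_projL, sub_eq_zero] at h2
    simp only [Matrix.mul_assoc, Matrix.mul_add, Matrix.add_mul, mul_projL_self_assoc,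
      projR_mul_self, Matrix.mul_zero, add_zero, ← h2, ← h1]

/-- The general solution of `A X + Y B = C`. -/
theorem mul_add_mul_eq_iff (A : QTensor I J) (B : QTensor K L) (C : QTensor I L)
    (X : QTensor J L) (Y : QTensor I K) :
    A * X + Y * B = C ↔
      projR A * C * projL B = 0 ∧
        ∃ (T : QTensor I K) (U : QTensor J L) (V : QTensor I K), X = A† * C - A† * T * B + projL A * U ∧
          Y = projR A * C * B† + A * A† * T + V * projR B := by
  constructor
  · rintro rfl
    -- Here `Y` splits as `R_A Y B B† + A A† Y + R_A Y R_B`, and `X` as `A† A X + L_A X`.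
    refine ⟨?_, Y, X, projR A * Y, ?_, ?_⟩
    · rw [Matrix.mul_add, projR_mul_self_assoc, zero_add, Matrix.mul_assoc, Matrix.mul_assoc,
        mul_projL_self, Matrix.mul_zero, Matrix.mul_zero]
    · simp only [Matrix.mul_assoc, projL_mul, Matrix.mul_add]
      abel
    · simp only [Matrix.mul_assoc, mul_projR, projR_mul, Matrix.mul_add, Matrix.add_mul,
        Matrix.sub_mul, Matrix.mul_sub, mul_mpInv_mul_assoc]
      abel
  · rintro ⟨h, T, U, V, rfl, rfl⟩
    rw [mul_projL, sub_eq_zero] at h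
    simp only [Matrix.mul_assoc, Matrix.mul_add, Matrix.add_mul, Matrix.mul_sub,
      mul_projL_self_assoc, projR_mul_self, Matrix.mul_zero, add_zero] at h ⊢
    rw [← h, projR_mul]
    abel

/-- The general solution of `A X + Y B = C`, in a second parametrization. -/
theorem mul_add_mul_eq_iff' (A : QTensor I J) (B : QTensor K L) (C : QTensor I L)
    (X : QTensor J L) (Y : QTensor I K) :
    A * X + Y * B = C ↔
      projR A * C * projL B = 0 ∧
        ∃ (T : QTensor J K) (U : QTensor J L) (V : QTensor I K), X = A† * C + T * B + projL A * U ∧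
          Y = projR A * C * B† - A * T - V * projR B := by
  constructor
  · intro h
    obtain ⟨h', T, U, V, rfl, rfl⟩ := (mul_add_mul_eq_iff A B C X Y).1 h
    -- The first parametrization involves `T` only through `A† T`, so this product, up to sign, is
    -- the new parameter.
    refine ⟨h', -(A† * T), U, -V, ?_, ?_⟩
    · rw [Matrix.neg_mul]; abel
    · rw [Matrix.neg_mul, Matrix.mul_neg, Matrix.mul_assoc A]; abel
  · rintro ⟨h, T, U, V, rfl, rfl⟩
    rw [mul_projL, sub_eq_zero] at h
    simp only [Matrix.mul_assoc, Matrix.mul_add, Matrix.sub_mul,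
      mul_projL_self_assoc, projR_mul_self, Matrix.mul_zero, add_zero, sub_zero] at h ⊢
    rw [← h, projR_mul]
    abel

/-- The general solution of `A X B + C Y D = E`. -/
theorem mul_mul_add_mul_mul_eq_iff (A : QTensor I J) (B : QTensor K L) (C : QTensor I P)
    (D : QTensor Q L) (E : QTensor I L) {R : QTensor I P} {T : QTensor Q L} {S : QTensor I P}
    (hM : R = projR A * C) (hN : T = D * projL B) (hS : S = C * projL R)
    (X : QTensor J K) (Y : QTensor P Q) :
    A * X * B + C * Y * D = E ↔
      (projR R * projR A * E = 0 ∧ projR A * E * projL D = 0 ∧ E * projL B * projL T = 0 ∧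
        projR C * E * projL B = 0) ∧
      ∃ (V : QTensor P Q) (U₁ U₂ : QTensor J K) (V₁ V₂ : QTensor P Q),
        X = A† * E * B† - A† * S * C† * E * T† * D * B† - A† * C * R† * E * B†
          - A† * S * V * projR T * D * B† + projL A * U₁ + U₂ * projR B ∧
        Y = R† * E * D† + S† * S * C† * E * T† + projL R * projL S * V₁ + projL R * V * projR T
          + V₂ * projR D := by
  -- The inverses of `R`, `T`, `S` absorb the projections out of which these tensors are built; all
  -- later identities rest on this.
  have hMA : R† * projR A = R† := mpInv_mul_of_mul_eq (conjTranspose_projR A)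
    (by rw [hM, ← Matrix.mul_assoc, projR_mul_projR])
  have hNB : projL B * T† = T† := mul_mpInv_of_mul_eq (conjTranspose_projL B)
    (by rw [hN, Matrix.mul_assoc, projL_mul_projL])
  have hSM : projL R * S† = S† := mul_mpInv_of_mul_eq (conjTranspose_projL R)
    (by rw [hS, Matrix.mul_assoc, projL_mul_projL])
  have hMC : R† * C = R† * R := by
    conv_rhs => rw [hM, ← Matrix.mul_assoc, ← hM, hMA]
  have hCS : C * S† = S * S† := by rw [hS, Matrix.mul_assoc, ← hS, hSM]
  have hC : C = S + C * (R† * R) := by rw [hS, mul_projL]; abel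
  -- `S` has its range inside that of `A`, because `R_A S = R L_R = 0`.
  have hRS : A * (A† * S) = S := by
    have : projR A * S = 0 := by rw [hS, ← Matrix.mul_assoc, ← hM, mul_projL_self]
    rw [projR_mul, sub_eq_zero] at this; exact this.symm
  have hDN : projR T * (D * (B† * B)) = projR T * D := by
    have : projR T * (D * projL B) = 0 := by rw [← hN, projR_mul_self]
    rw [mul_projL, Matrix.mul_sub, sub_eq_zero] at this; exact this.symm
  constructor
  · intro h
    have hRE : projR A * E = R * Y * D := by
      rw [← h, Matrix.mul_add, Matrix.mul_assoc, projR_mul_self_assoc, zero_add, hM]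
      simp only [Matrix.mul_assoc]
    have hEL : E * projL B = C * Y * T := by
      rw [← h, Matrix.add_mul, Matrix.mul_assoc _ B, mul_projL_self, Matrix.mul_zero, zero_add, hN]
      simp only [Matrix.mul_assoc]
    have hME : R† * E = R† * (R * (Y * D)) := by
      rw [← hMA, Matrix.mul_assoc, hRE, hMA]; simp only [Matrix.mul_assoc]
    have hEN : E * T† = C * (Y * (T * T†)) := by
      rw [← hNB, ← Matrix.mul_assoc, hEL, hNB]; simp only [Matrix.mul_assoc]
    have hSC : S * (C† * C) = S := by
      have h1 : R * (C† * C) = R := by rw [hM, Matrix.mul_assoc, mul_mpInv_mul]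
      rw [hS, mul_projL, Matrix.sub_mul, mul_mpInv_mul]
      simp only [Matrix.mul_assoc, h1]
    have hSE : S * (C† * (E * T†)) = S * (Y * (T * T†)) := by
      rw [hEN, ← Matrix.mul_assoc C†, ← Matrix.mul_assoc S, hSC]
    -- The parameters follow the decomposition `Y = R† R Y + S† S Y + L_R L_S Y`: its first term is
    -- split further by `D D†` and `R_D`, its second by `T T†` and `R_T`.
    refine ⟨⟨?_, ?_, ?_, ?_⟩, S† * (S * Y), X, A† * (A * X), Y, R† * (R * Y), ?_, ?_⟩
    · rw [Matrix.mul_assoc, hRE, Matrix.mul_assoc, projR_mul_self_assoc]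
    · rw [hRE, Matrix.mul_assoc, mul_projL_self, Matrix.mul_zero]
    · rw [hEL, Matrix.mul_assoc, mul_projL_self, Matrix.mul_zero]
    · rw [Matrix.mul_assoc, hEL, Matrix.mul_assoc, projR_mul_self_assoc]
    -- What is subtracted from `E` adds up to `C Y D`, since `C = S + C R† R`; hence `A X B`
    -- remains, and `A† A X B B†` is the fixed part of `X`.
    · have h2 : E - S * (C† * (E * T†)) * D - C * (R† * E) - S * (S† * (S * Y)) * projR T * D
          = A * X * B := by
        rw [hSE, hME, mul_mpInv_mul_assoc, ← h]
        have : C * Y * D = S * Y * D + C * (R† * (R * (Y * D))) := by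
          conv_lhs => rw [hC]
          simp only [Matrix.add_mul, Matrix.mul_assoc]
        rw [this]
        simp only [mul_projR, Matrix.sub_mul, Matrix.mul_sub, Matrix.mul_assoc]
        abel
      have h3 := congrArg (fun Z => A† * (Z * B†)) h2
      simp only [Matrix.sub_mul, Matrix.mul_sub, Matrix.mul_assoc] at h3 ⊢
      rw [h3, projL_mul, mul_projR]
      simp only [Matrix.mul_sub]
      abel
    · have h4 : R† * E * D† = R† * (R * (Y * (D * D†))) := by
        rw [hME]; simp only [Matrix.mul_assoc]
      have h5 : S† * S * C† * E * T† = S† * (S * (Y * (T * T†))) := by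
        simp only [Matrix.mul_assoc, hSE]
      have h6 : projL R * (S† * (S * Y)) = S† * (S * Y) := by
        rw [← Matrix.mul_assoc, hSM]
      have h7 : projL R * projL S * Y = Y - R† * (R * Y) - S† * (S * Y) := by
        rw [Matrix.mul_assoc, projL_mul S, Matrix.mul_sub, h6, projL_mul]
      rw [h4, h5, h6, h7, mul_projR, mul_projR]
      simp only [Matrix.mul_assoc]
      abel
  · rintro ⟨⟨h1, h2, h3, h4⟩, V, U₁, U₂, V₁, V₂, rfl, rfl⟩
    have hRE : projR A * E = R * (R† * E) := by
      rw [Matrix.mul_assoc, projR_mul, sub_eq_zero, ← Matrix.mul_assoc R†, hMA] at h1; exact h1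
    have hME : R† * (E * (D† * D)) = R† * E := by
      have : R† * (E * projL D) = 0 := by
        rw [← hMA, Matrix.mul_assoc, ← Matrix.mul_assoc (projR A), h2, Matrix.mul_zero]
      rw [mul_projL, Matrix.mul_sub, sub_eq_zero] at this; exact this.symm
    have hEN : E * (T† * T) = E * projL B := by
      rw [mul_projL, sub_eq_zero, Matrix.mul_assoc, ← Matrix.mul_assoc (projL B), hNB] at h3
      exact h3.symm
    have hCE : C * (C† * (E * projL B)) = E * projL B := by
      rw [Matrix.mul_assoc, projR_mul, sub_eq_zero] at h4; exact h4.symm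
    have hAE : A * (A† * (E - C * (R† * E))) = E - C * (R† * E) := by
      have : projR A * (E - C * (R† * E)) = 0 := by
        rw [Matrix.mul_sub, hRE, ← Matrix.mul_assoc _ C, ← hM, sub_self]
      rw [projR_mul, sub_eq_zero] at this; exact this.symm
    have hSE : S * (C† * (E * projL B)) = E * projL B - C * (R† * (E * projL B)) := by
      rw [hS, Matrix.mul_assoc, projL_mul, ← Matrix.mul_assoc R†, ← hMC, Matrix.mul_assoc R†, hCE,
        Matrix.mul_sub, hCE]
    -- In `A X B + C Y D` the terms `S V R_T D` cancel. What is left equals `E` as soon as `E - C R†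
    -- E - Z D` is unchanged by `B† B` on the right, and `hZ'` provides this.
    set Z := S * (C† * (E * T†)) with hZ
    have hZ' : Z * (D * projL B) = E * projL B - C * (R† * (E * projL B)) := by
      rw [← hN, hZ, ← hSE, ← hEN]
      simp only [Matrix.mul_assoc]
    have hX : A * (A† * E * B† - A† * S * C† * E * T† * D * B† - A† * C * R† * E * B†
          - A† * S * V * projR T * D * B† + projL A * U₁ + U₂ * projR B) * B
        = (E - C * (R† * E) - Z * D) * (B† * B) - S * (V * (projR T * D)) := by
      have e1 : A * (A† * E * B† - A† * S * C† * E * T† * D * B† - A† * C * R† * E * B†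
          - A† * S * V * projR T * D * B† + projL A * U₁ + U₂ * projR B) * B
        = A * (A† * (E - C * (R† * E))) * (B† * B)
          - A * (A† * S) * (C† * (E * T†)) * (D * (B† * B))
          - A * (A† * S) * (V * (projR T * (D * (B† * B)))) := by
        simp only [Matrix.mul_add, Matrix.add_mul, Matrix.mul_sub, Matrix.sub_mul, Matrix.mul_assoc,
          mul_projL_self_assoc, projR_mul_self, Matrix.mul_zero, add_zero]
        abel
      rw [e1, hAE, hRS, hDN, ← hZ]
      simp only [Matrix.sub_mul, Matrix.mul_assoc]
    have hY : C * (R† * E * D† + S† * S * C† * E * T† + projL R * projL S * V₁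
          + projL R * V * projR T + V₂ * projR D) * D
        = C * (R† * E) + Z * D + S * (V * (projR T * D)) := by
      have e1 : C * (R† * E * D† + S† * S * C† * E * T† + projL R * projL S * V₁
          + projL R * V * projR T + V₂ * projR D) * D
        = C * (R† * (E * (D† * D))) + (C * S†) * (S * (C† * (E * T†))) * D
          + (C * projL R) * (projL S * (V₁ * D)) + (C * projL R) * (V * (projR T * D)) := by
        simp only [Matrix.mul_add, Matrix.add_mul, Matrix.mul_assoc, projR_mul_self,
          Matrix.mul_zero, add_zero]
      rw [e1, hME, hCS, ← hS, mul_projL_self_assoc, add_zero, Matrix.mul_assoc S,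
        mul_mpInv_mul_assoc]
    rw [hX, hY]
    have h8 : (E - C * (R† * E) - Z * D) * projL B = 0 := by
      simp only [Matrix.sub_mul, Matrix.mul_assoc]
      rw [hZ', sub_self]
    rw [mul_projL, sub_eq_zero] at h8
    rw [← h8]
    abel

end MoorePenrose

/-! ### Block tensors -/

section Blocks

variable {a b c : ℕ}

/-- The embedding of multi-indices into the first block. -/
def MultiIdx.inl {J K : Fin a → ℕ} (j : MultiIdx J) : MultiIdx (fun s => J s + K s) :=
  fun s => Fin.castAdd (K s) (j s)

/-- The embedding of multi-indices into the second block. -/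
def MultiIdx.inr {J K : Fin a → ℕ} (k : MultiIdx K) : MultiIdx (fun s => J s + K s) :=
  fun s => Fin.natAdd (J s) (k s)

theorem MultiIdx.inl_injective {J K : Fin a → ℕ} :
    Function.Injective (MultiIdx.inl : MultiIdx J → MultiIdx (fun s => J s + K s)) :=
  fun _ _ h => funext fun s => Fin.castAdd_injective _ _ (congrFun h s)

theorem MultiIdx.inr_injective {J K : Fin a → ℕ} :
    Function.Injective (MultiIdx.inr : MultiIdx K → MultiIdx (fun s => J s + K s)) :=
  fun _ _ h => funext fun s => Fin.natAdd_injective _ _ (congrFun h s)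

/-- Any single coordinate separates the blocks. Positive order is essential: for order zero the only
multi-index belongs to both. -/
theorem MultiIdx.inl_ne_inr (ha : 0 < a) {J K : Fin a → ℕ} (j : MultiIdx J) (k : MultiIdx K) :
    (MultiIdx.inl j : MultiIdx (fun s => J s + K s)) ≠ MultiIdx.inr k := by
  intro h
  have h1 := congrArg Fin.val (congrFun h ⟨0, ha⟩)
  have h2 := (j ⟨0, ha⟩).isLt
  simp only [MultiIdx.inl, MultiIdx.inr, Fin.val_castAdd, Fin.val_natAdd] at h1
  omega

variable {I : Fin b → ℕ} {J K : Fin a → ℕ}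

theorem rowBlock_inl (A : QTensor I J) (B : QTensor I K) (i : MultiIdx I) (j : MultiIdx J) :
    rowBlock A B i (MultiIdx.inl j) = A i j := by
  have h : ∀ s, ((MultiIdx.inl j : MultiIdx (fun s => J s + K s)) s : ℕ) < J s := fun s => (j s).isLt
  rw [rowBlock, dif_pos h]
  rfl

theorem rowBlock_inr (ha : 0 < a) (A : QTensor I J) (B : QTensor I K) (i : MultiIdx I)
    (k : MultiIdx K) : rowBlock A B i (MultiIdx.inr k) = B i k := by
  have h : ¬ ∀ s, ((MultiIdx.inr k : MultiIdx (fun s => J s + K s)) s : ℕ) < J s := by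
    intro h
    have := h ⟨0, ha⟩
    simp only [MultiIdx.inr, Fin.val_natAdd] at this
    omega
  have h' : ∀ s, J s ≤ ((MultiIdx.inr k : MultiIdx (fun s => J s + K s)) s : ℕ) := by
    intro s
    simp only [MultiIdx.inr, Fin.val_natAdd]
    omega
  rw [rowBlock, dif_neg h, dif_pos h']
  congr 1
  funext s
  ext
  simp [MultiIdx.inr]

theorem rowBlock_eq_zero (A : QTensor I J) (B : QTensor I K) (i : MultiIdx I)
    {l : MultiIdx (fun s => J s + K s)} (h1 : ∀ j, MultiIdx.inl j ≠ l)
    (h2 : ∀ k, MultiIdx.inr k ≠ l) : rowBlock A B i l = 0 := by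
  rw [rowBlock, dif_neg, dif_neg]
  · intro h
    refine h2 (fun s => ⟨(l s : ℕ) - J s, by
      have h₁ : (l s : ℕ) < J s + K s := (l s).isLt; have := h s; omega⟩) (funext fun s => ?_)
    ext
    simp only [MultiIdx.inr, Fin.val_natAdd]
    have := h s
    omega
  · intro h
    exact h1 (fun s => ⟨l s, h s⟩) (funext fun s => by ext; rfl)

/-- For order at least two the blocks do not exhaust the multi-indices: some lie in the first range
in one coordinate and in the second in another. The hypothesis `hf` removes these mixed indices,
where block tensors are zero. -/
theorem sum_eq_sum_inl_add_sum_inr (ha : 0 < a) {R : Type*} [AddCommMonoid R]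
    (f : MultiIdx (fun s => J s + K s) → R)
    (hf : ∀ l, (∀ j, MultiIdx.inl j ≠ l) → (∀ k, MultiIdx.inr k ≠ l) → f l = 0) :
    ∑ l, f l = ∑ j, f (MultiIdx.inl j) + ∑ k, f (MultiIdx.inr k) := by
  classical
  have hinj : Function.Injective
      (Sum.elim (MultiIdx.inl : MultiIdx J → MultiIdx (fun s => J s + K s)) MultiIdx.inr) :=
    MultiIdx.inl_injective.sumElim MultiIdx.inr_injective (MultiIdx.inl_ne_inr ha)
  have h := Fintype.sum_sum_type fun x : MultiIdx J ⊕ MultiIdx K =>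
    f (Sum.elim MultiIdx.inl MultiIdx.inr x)
  rw [← Finset.sum_image (s := Finset.univ) (f := f) (fun x _ y _ h => hinj h)] at h
  simp only [Sum.elim_inl, Sum.elim_inr] at h
  rw [← h]
  symm
  refine Finset.sum_subset (Finset.subset_univ _) fun l _ hl => hf l ?_ ?_
  · exact fun j hj => hl (Finset.mem_image.2 ⟨Sum.inl j, Finset.mem_univ _, hj⟩)
  · exact fun k hk => hl (Finset.mem_image.2 ⟨Sum.inr k, Finset.mem_univ _, hk⟩)

theorem rowBlock_mul (ha : 0 < a) {L : Fin c → ℕ} (A : QTensor I J) (B : QTensor I K)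
    (X : QTensor (fun s => J s + K s) L) :
    rowBlock A B * X = A * (X.submatrix MultiIdx.inl id : QTensor J L)
      + B * (X.submatrix MultiIdx.inr id : QTensor K L) := by
  ext1 i l
  simp only [Matrix.add_apply, Matrix.mul_apply, Matrix.submatrix_apply, id]
  rw [sum_eq_sum_inl_add_sum_inr ha _ fun l h1 h2 => by rw [rowBlock_eq_zero A B i h1 h2, zero_mul]]
  simp only [rowBlock_inl, rowBlock_inr ha]

/-- Used for entries only: over the quaternions transposition does not reverse products, so the
product formula for columns needs its own proof. -/
theorem colBlock_eq_transpose (C : QTensor J I) (D : QTensor K I) :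
    colBlock C D = (rowBlock (Cᵀ : QTensor I J) (Dᵀ : QTensor I K))ᵀ := rfl

theorem colBlock_inl (C : QTensor J I) (D : QTensor K I) (j : MultiIdx J) (i : MultiIdx I) :
    colBlock C D (MultiIdx.inl j) i = C j i := by
  rw [colBlock_eq_transpose, transpose_apply, rowBlock_inl, transpose_apply]

theorem colBlock_inr (ha : 0 < a) (C : QTensor J I) (D : QTensor K I) (k : MultiIdx K)
    (i : MultiIdx I) : colBlock C D (MultiIdx.inr k) i = D k i := by
  rw [colBlock_eq_transpose, transpose_apply, rowBlock_inr ha, transpose_apply]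

theorem mul_colBlock (ha : 0 < a) {L : Fin c → ℕ} (C : QTensor J I) (D : QTensor K I)
    (X : QTensor L (fun s => J s + K s)) :
    X * colBlock C D = (X.submatrix id MultiIdx.inl : QTensor L J) * C
      + (X.submatrix id MultiIdx.inr : QTensor L K) * D := by
  ext1 l i
  simp only [Matrix.add_apply, Matrix.mul_apply, Matrix.submatrix_apply, id]
  rw [sum_eq_sum_inl_add_sum_inr ha _ fun l h1 h2 => by
    rw [colBlock_eq_transpose, transpose_apply, rowBlock_eq_zero _ _ i h1 h2, mul_zero]]
  simp only [colBlock_inl, colBlock_inr ha]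

theorem selTop_mul (ha : 0 < a) (X : QTensor (fun s => J s + J s) I) :
    selTop J * X = X.submatrix MultiIdx.inl id := by
  rw [selTop, rowBlock_mul ha, Matrix.one_mul, Matrix.zero_mul, add_zero]

theorem mul_selLeft (ha : 0 < a) (X : QTensor I (fun s => J s + J s)) :
    X * selLeft J = X.submatrix id MultiIdx.inl := by
  rw [selLeft, mul_colBlock ha, Matrix.mul_one, Matrix.mul_zero, add_zero]

theorem selTop_mul_colBlock (ha : 0 < a) (C D : QTensor J I) : selTop J * colBlock C D = C := by
  rw [selTop_mul ha]; ext1 i j; exact colBlock_inl C D i j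

theorem rowBlock_mul_selLeft (ha : 0 < a) (C D : QTensor I J) : rowBlock C D * selLeft J = C := by
  rw [mul_selLeft ha]; ext1 i j; exact rowBlock_inl C D i j

theorem rowBlock_mul_colBlock (ha : 0 < a) {L : Fin c → ℕ} (A : QTensor I J) (B : QTensor I K)
    (C : QTensor J L) (D : QTensor K L) : rowBlock A B * colBlock C D = A * C + B * D := by
  rw [rowBlock_mul ha]
  congr 2
  · ext1 j l; exact colBlock_inl C D j l
  · ext1 k l; exact colBlock_inr ha C D k l

/-! ### Elimination of unknowns through block equations -/

variable {d : ℕ} {L : Fin c → ℕ} {T : Fin d → ℕ}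

/-- Eliminating the lower and the right block of unknowns from a block equation. -/
theorem exists_add_eq_iff_exists_block (ha : 0 < a) (hc : 0 < c) (A B : QTensor I J)
    (C D : QTensor L T) (E : QTensor I T) (U : QTensor J T) (V : QTensor I L) :
    (∃ (U' : QTensor J T) (V' : QTensor I L), A * U + B * U' + (V * C + V' * D) = E) ↔
      ∃ (X : QTensor (fun s => J s + J s) T) (Y : QTensor I (fun s => L s + L s)),
        rowBlock A B * X + Y * colBlock C D = E ∧ U = selTop J * X ∧ V = Y * selLeft L := by
  constructor
  · rintro ⟨U', V', h⟩
    refine ⟨colBlock U U', rowBlock V V', ?_, (selTop_mul_colBlock ha U U').symm,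
      (rowBlock_mul_selLeft hc V V').symm⟩
    rw [rowBlock_mul_colBlock ha, rowBlock_mul_colBlock hc, h]
  -- Entries of `X` and `Y` at mixed indices are multiplied by zeros, so only the two proper blocks
  -- count; the second ones are `U'` and `V'`.
  · rintro ⟨X, Y, h, rfl, rfl⟩
    rw [rowBlock_mul ha, mul_colBlock hc] at h
    rw [selTop_mul ha, mul_selLeft hc]
    exact ⟨_, _, h⟩

theorem exists_add_eq_iff (ha : 0 < a) (hc : 0 < c) (A B : QTensor I J)
    (C D : QTensor L T) (E : QTensor I T) (U : QTensor J T) (V : QTensor I L) :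
    (∃ (U' : QTensor J T) (V' : QTensor I L), A * U + B * U' + (V * C + V' * D) = E) ↔
      projR (rowBlock A B) * E * projL (colBlock C D) = 0 ∧
      ∃ (H₁ : QTensor (fun s => J s + J s) T) (H₂ H₃ : QTensor I (fun s => L s + L s)),
        U = selTop J * ((rowBlock A B)† * E - (rowBlock A B)† * H₂ * colBlock C D
          + projL (rowBlock A B) * H₁) ∧
        V = (projR (rowBlock A B) * E * (colBlock C D)† + rowBlock A B * (rowBlock A B)† * H₂
          + H₃ * projR (colBlock C D)) * selLeft L := by
  rw [exists_add_eq_iff_exists_block ha hc]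
  simp only [mul_add_mul_eq_iff]
  constructor
  · rintro ⟨X, Y, ⟨h, S, U, V, rfl, rfl⟩, rfl, rfl⟩
    exact ⟨h, U, S, V, rfl, rfl⟩
  · rintro ⟨h, U, S, V, rfl, rfl⟩
    exact ⟨_, _, ⟨h, S, U, V, rfl, rfl⟩, rfl, rfl⟩

theorem exists_add_eq_iff' (ha : 0 < a) (hc : 0 < c) (A B : QTensor I J)
    (C D : QTensor L T) (E : QTensor I T) (U : QTensor J T) (V : QTensor I L) :
    (∃ (U' : QTensor J T) (V' : QTensor I L), A * U + B * U' + (V * C + V' * D) = E) ↔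
      projR (rowBlock A B) * E * projL (colBlock C D) = 0 ∧
      ∃ (W₁ : QTensor (fun s => J s + J s) (fun s => L s + L s))
        (W₂ : QTensor (fun s => J s + J s) T) (W₃ : QTensor I (fun s => L s + L s)),
        U = selTop J * ((rowBlock A B)† * E + W₁ * colBlock C D + projL (rowBlock A B) * W₂) ∧
        V = (projR (rowBlock A B) * E * (colBlock C D)† - rowBlock A B * W₁
          - W₃ * projR (colBlock C D)) * selLeft L := by
  rw [exists_add_eq_iff_exists_block ha hc]
  simp only [mul_add_mul_eq_iff']
  constructor
  · rintro ⟨X, Y, ⟨h, S, U, V, rfl, rfl⟩, rfl, rfl⟩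
    exact ⟨h, S, U, V, rfl, rfl⟩
  · rintro ⟨h, S, U, V, rfl, rfl⟩
    exact ⟨_, _, ⟨h, S, U, V, rfl, rfl⟩, rfl, rfl⟩

/-- Equating two parametrizations of one tensor puts the second family on the right; a sign change
of its parameters brings it to the left. -/
theorem exists_add_eq_add_iff (A B : QTensor I J)
    (C D : QTensor L T) (Z Z' : QTensor I T) (U : QTensor J T) (V : QTensor I L) :
    (∃ (U' : QTensor J T) (V' : QTensor I L), A * U + V * C + Z = B * U' + V' * D + Z') ↔
      ∃ (U' : QTensor J T) (V' : QTensor I L), A * U + B * U' + (V * C + V' * D) = Z' - Z := by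
  constructor <;> rintro ⟨U', V', h⟩ <;> refine ⟨-U', -V', ?_⟩ <;> rw [← sub_eq_zero] at h ⊢ <;>
    rw [← h, Matrix.neg_mul, Matrix.mul_neg] <;> abel

/-- The members of an affine family `A U + V C + Z` which solve `P X Q = F`. -/
theorem mul_add_mul_eq_iff_of_affine {e : ℕ} {S : Fin e → ℕ}
    {I : Fin a → ℕ} {K : Fin c → ℕ} (ha : 0 < a) (hc : 0 < c)
    (A : QTensor I I) (C : QTensor K K) (Z : QTensor I K) (P : QTensor S I)
    (Q : QTensor K T) (F : QTensor S T) (U V : QTensor I K) :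
    P * (A * U + V * C + Z) * Q = F ↔
      ((projR P * F = 0 ∧ F * projL Q = 0) ∧
        projR (rowBlock A (projL P)) * (P† * F * Q† - Z) * projL (colBlock C (projR Q)) = 0) ∧
      ∃ (H₁ : QTensor (fun s => I s + I s) K) (H₂ H₃ : QTensor I (fun s => K s + K s)),
        U = selTop I * ((rowBlock A (projL P))† * (P† * F * Q† - Z)
          - (rowBlock A (projL P))† * H₂ * colBlock C (projR Q)
          + projL (rowBlock A (projL P)) * H₁) ∧
        V = (projR (rowBlock A (projL P)) * (P† * F * Q† - Z) * (colBlock C (projR Q))†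
          + rowBlock A (projL P) * (rowBlock A (projL P))† * H₂
          + H₃ * projR (colBlock C (projR Q))) * selLeft K := by
  -- The family is compared with the general solution of `P X Q = F`, whose own two parameters are
  -- then eliminated.
  rw [mul_mul_eq_iff, @and_assoc (projR P * F = 0 ∧ F * projL Q = 0)]
  refine and_congr_right fun _ => Iff.trans ?_ (exists_add_eq_iff ha hc _ _ _ _ _ _ _)
  refine Iff.trans ?_ (exists_add_eq_add_iff _ _ _ _ _ _ _ _)
  refine exists_congr fun U' => exists_congr fun V' => ?_
  rw [show projL P * U' + V' * projR Q + P† * F * Q† = P† * F * Q† + projL P * U' + V' * projR Q by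
    abel]

end Blocks

/-! ### Consistency conditions and Sylvester equations -/

section MoorePenrose

variable {a b c d e f : ℕ} {I : Fin a → ℕ} {J : Fin b → ℕ} {K : Fin c → ℕ} {L : Fin d → ℕ}
  {P : Fin e → ℕ} {Q : Fin f → ℕ}

/-- Reads the consistency condition of one elimination as the equation for the next; its
coefficients unfold to tensors such as `A33`, `B33`, `E33`. -/
theorem projR_mul_sub_mul_projL_eq_zero_iff (A : QTensor I J) (B : QTensor K L) (E : QTensor I L)
    (C : QTensor I P) (D : QTensor Q L) (V : QTensor P Q) :
    projR A * (E - C * V * D) * projL B = 0 ↔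
      projR A * C * V * (D * projL B) = projR A * E * projL B := by
  rw [Matrix.mul_sub, Matrix.sub_mul, sub_eq_zero, eq_comm]
  simp only [Matrix.mul_assoc]

theorem projR_mul_sub_sub_mul_projL_eq_zero_iff {g h : ℕ} {P' : Fin g → ℕ} {Q' : Fin h → ℕ}
    (A : QTensor I J) (B : QTensor K L) (E : QTensor I L)
    (C : QTensor I P) (D : QTensor Q L) (V : QTensor P Q)
    (C' : QTensor I P') (D' : QTensor Q' L) (V' : QTensor P' Q') :
    projR A * (E - C * V * D - C' * V' * D') * projL B = 0 ↔
      projR A * C * V * (D * projL B) + projR A * C' * V' * (D' * projL B)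
        = projR A * E * projL B := by
  rw [projR_mul_sub_mul_projL_eq_zero_iff, Matrix.mul_sub, Matrix.sub_mul, eq_sub_iff_add_eq']
  simp only [Matrix.mul_assoc]

/-- The solutions `(X, Y)` of `A X + Y B + C Z D + C' Z' D' = E`. -/
theorem sylvester_eq_iff {g h : ℕ} {P' : Fin g → ℕ} {Q' : Fin h → ℕ}
    (A : QTensor I J) (B : QTensor K L) (E : QTensor I L)
    (C : QTensor I P) (D : QTensor Q L) (Z : QTensor P Q)
    (C' : QTensor I P') (D' : QTensor Q' L) (Z' : QTensor P' Q')
    (X : QTensor J L) (Y : QTensor I K) :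
    A * X + Y * B + C * Z * D + C' * Z' * D' = E ↔
      projR A * C * Z * (D * projL B) + projR A * C' * Z' * (D' * projL B)
        = projR A * E * projL B ∧
      ∃ (T₂ : QTensor J K) (T₃ : QTensor I K) (T₄ : QTensor J L),
        X = A† * (E - C * Z * D - C' * Z' * D') - T₂ * B + projL A * T₄ ∧
        Y = projR A * (E - C * Z * D - C' * Z' * D') * B† + A * T₂ + T₃ * projR B := by
  have h1 : A * X + Y * B + C * Z * D + C' * Z' * D' = E ↔
      A * X + Y * B = E - C * Z * D - C' * Z' * D' := by
    rw [sub_sub, eq_sub_iff_add_eq, add_assoc (A * X + Y * B)]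
  -- What remains is a change of sign in two of the three parameters.
  rw [h1, mul_add_mul_eq_iff', projR_mul_sub_sub_mul_projL_eq_zero_iff]
  refine and_congr_right fun _ => ⟨?_, ?_⟩
  · rintro ⟨T, U, V, rfl, rfl⟩
    refine ⟨-T, -V, U, ?_, ?_⟩ <;>
      simp only [Matrix.neg_mul, Matrix.mul_neg, sub_neg_eq_add, ← sub_eq_add_neg]
  · rintro ⟨T, V, U, rfl, rfl⟩
    refine ⟨-T, U, -V, ?_, ?_⟩ <;>
      simp only [Matrix.neg_mul, Matrix.mul_neg, sub_neg_eq_add, ← sub_eq_add_neg]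

/-- Substituting the general solution of `A W = E₁`, `W B = E₂`. -/
theorem add_mul_mul_eq_iff_of_affine {g h : ℕ} {S : Fin g → ℕ} {T : Fin h → ℕ}
    (A : QTensor I J) (B : QTensor K L) (E₁ : QTensor I K) (E₂ : QTensor J L)
    (C : QTensor S J) (D : QTensor K T) (F H : QTensor S T) (U : QTensor J K) :
    F + C * (A† * E₁ + projL A * E₂ * B† + projL A * U * projR B) * D = H ↔
      F + C * projL A * U * (projR B * D)
        = H - C * A† * E₁ * D - C * projL A * E₂ * B† * D := by
  rw [sub_sub, eq_sub_iff_add_eq]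
  simp only [Matrix.mul_add, Matrix.add_mul, Matrix.mul_assoc]
  rw [add_assoc F, add_comm (_ + _) (C * (projL A * (U * _)))]

end MoorePenrose

/-! ### The system: both directions of the elimination -/

namespace SylvesterData

variable {N M : ℕ} {dI dJ dQ dP dA dE dC dR : Fin N → ℕ} {dL dK dS dT dH dB dO dD : Fin M → ℕ}
  (s : SylvesterData dI dJ dQ dP dA dE dC dR dL dK dS dT dH dB dO dD)

theorem exists_eq_sol_of_isSolution (hN : 0 < N) (hM : 0 < M) {X1 : QTensor dE dB}
    {X2 : QTensor dA dH} {X3 : QTensor dJ dL} {Y1 : QTensor dR dD} {Y2 : QTensor dC dO}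
    {Y3 : QTensor dQ dS} {W : QTensor dP dT} (h : s.IsSolution X1 X2 X3 Y1 Y2 Y3 W) :
    s.SolvabilityConditions ∧ ∃ p : FreeTensors dJ dQ dP dA dE dC dR dL dS dT dH dB dO dD,
      X1 = s.solX1 p ∧ X2 = s.solX2 p ∧ X3 = s.solX3 p ∧
      Y1 = s.solY1 p ∧ Y2 = s.solY2 p ∧ Y3 = s.solY3 p ∧ W = s.solW p := by
  obtain ⟨h1, h2, h3, h4, h5, h6⟩ := h
  obtain ⟨⟨cX1, cX2⟩, U1, U2, hX3⟩ := (mul_mul_eq_iff _ _ _ _).1 h1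
  obtain ⟨⟨cY1, cY2⟩, U3, U4, hY3⟩ := (mul_mul_eq_iff _ _ _ _).1 h2
  obtain ⟨⟨cW1, cW2, cW3⟩, U5, hW⟩ := (mul_eq_and_mul_eq_iff _ _ _ _ _).1 ⟨h3, h4⟩
  obtain ⟨hG, T21, T31, T41, hX1, hX2⟩ := (sylvester_eq_iff _ _ _ _ _ _ _ _ _ _ _).1 h5
  obtain ⟨hF, J21, J31, J41, hY1, hY2⟩ := (sylvester_eq_iff _ _ _ _ _ _ _ _ _ _ _).1 h6
  -- The fixed part of `W` moves into `calG`, while its free part `L_{A3} U5 R_{B3}` turns `C4h`,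
  -- `D4h` into `C6`, `D6`.
  have hG' : s.A4h * X3 * s.B4h + s.C6 * U5 * s.D6 = s.calG := by
    rw [hW] at hG
    exact (add_mul_mul_eq_iff_of_affine _ _ _ _ _ _ _ _ _).1 hG
  have hF' : s.A5h * Y3 * s.B5h + s.C7 * U5 * s.D7 = s.calF := by
    rw [hW] at hF
    exact (add_mul_mul_eq_iff_of_affine _ _ _ _ _ _ _ _ _).1 hF
  obtain ⟨⟨cG1, cG2, cG3, cG4⟩, V2, U1', U2', V1, V3, hX3', hU5⟩ :=
    (mul_mul_add_mul_mul_eq_iff s.A4h s.B4h s.C6 s.D6 s.calG (R := s.M1) (T := s.N1) (S := s.S1)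
      rfl rfl rfl _ _).1 hG'
  obtain ⟨⟨cF1, cF2, cF3, cF4⟩, T2', U3', U4', T1, T3, hY3', hU5'⟩ :=
    (mul_mul_add_mul_mul_eq_iff s.A5h s.B5h s.C7 s.D7 s.calF (R := s.M2) (T := s.N2) (S := s.S2)
      rfl rfl rfl _ _).1 hF'
  -- This sign makes the `T2` term enter the equation for `U5` in the same way as the `V2` term; it
  -- is also the source of the minus sign in `C44`.
  obtain ⟨T2, rfl⟩ : ∃ T2, T2' = -T2 := ⟨-T2', (neg_neg _).symm⟩
  -- the two expressions for `U5`
  obtain ⟨cV, W1, W2, W3, hV1, hV3⟩ := (exists_add_eq_iff' hN hM (projL s.M1 * projL s.S1)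
    (projL s.M2 * projL s.S2) (projR s.D6) (projR s.D7)
    (s.E11 - projL s.M1 * V2 * projR s.N1 - projL s.M2 * T2 * projR s.N2) V1 V3).1 ⟨-T1, -T3, by
      have := hU5.symm.trans hU5'
      rw [← sub_eq_zero] at this ⊢
      rw [← this, E11]
      simp only [Matrix.mul_neg, Matrix.neg_mul]
      abel⟩
  -- The compression by `A11` and `B11` has removed `V1`, `V3`, `T1`, `T3`.
  have hE : s.calA * V2 * s.calB + s.calC * T2 * s.calD = s.calE :=
    (projR_mul_sub_sub_mul_projL_eq_zero_iff _ _ _ _ _ _ _ _ _).1 cV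
  -- the two expressions for `X3`
  obtain ⟨cU, H11, H12, H13, hU1, hU2⟩ := (exists_add_eq_iff hN hM (projL s.A1) (projL s.A4h)
    (projR s.B1) (projR s.B4h) (s.E22 - s.C22 * V2 * s.D22) U1 U2).1 ⟨-U1', -U2', by
      have := hX3.symm.trans hX3'
      rw [← sub_eq_zero] at this ⊢
      rw [← this, E22, C22, D22]
      simp only [Matrix.mul_neg, Matrix.neg_mul, Matrix.mul_assoc]
      abel⟩
  have hV2 : s.A33 * V2 * s.B33 = s.E33 := (projR_mul_sub_mul_projL_eq_zero_iff _ _ _ _ _ _).1 cU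
  -- the two expressions for `Y3`
  obtain ⟨cU', H21, H22, H23, hU3, hU4⟩ := (exists_add_eq_iff hN hM (projL s.A2) (projL s.A5h)
    (projR s.B2) (projR s.B5h) (s.E44 - s.C44 * T2 * s.D44) U3 U4).1 ⟨-U3', -U4', by
      have := hY3.symm.trans hY3'
      rw [← sub_eq_zero] at this ⊢
      rw [← this, E44, C44, D44]
      simp only [Matrix.mul_neg, Matrix.neg_mul, Matrix.mul_assoc]
      abel⟩
  have hT2 : s.A55 * T2 * s.B55 = s.E55 := (projR_mul_sub_mul_projL_eq_zero_iff _ _ _ _ _ _).1 cU'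
  obtain ⟨⟨cE1, cE2, cE3, cE4⟩, W4, W5, W6, W7, W8, hV2', hT2'⟩ :=
    (mul_mul_add_mul_mul_eq_iff s.calA s.calB s.calC s.calD s.calE (R := s.calM) (T := s.calN)
      (S := s.calS) rfl rfl rfl _ _).1 hE
  -- The part of `V2` that does not involve `W5`, `W6` depends on `W4`; this separates the
  -- dependence as `C66 W4 D66`.
  have e66 : s.E66 - s.C66 * W4 * s.D66 = s.A33† * s.E33 * s.B33† -
      (s.calA† * s.calE * s.calB†
        - s.calA† * s.calS * s.calC† * s.calE * s.calN† * s.calD * s.calB†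
        - s.calA† * s.calC * s.calM† * s.calE * s.calB†
        - s.calA† * s.calS * W4 * projR s.calN * s.calD * s.calB†) := by
    rw [E66, C66, D66]
    simp only [Matrix.neg_mul, Matrix.mul_assoc]
    abel
  have e88 : s.E88 - s.C88 * W4 * s.D88 = s.A55† * s.E55 * s.B55† -
      (s.calM† * s.calE * s.calD† + s.calS† * s.calS * s.calC† * s.calE * s.calN†
        + projL s.calM * W4 * projR s.calN) := by
    rw [E88, C88, D88]
    abel
  have hZ : projL s.calA * W5 + W6 * projR s.calB + (s.calA† * s.calE * s.calB†
        - s.calA† * s.calS * s.calC† * s.calE * s.calN† * s.calD * s.calB†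
        - s.calA† * s.calC * s.calM† * s.calE * s.calB†
        - s.calA† * s.calS * W4 * projR s.calN * s.calD * s.calB†) = V2 := by
    rw [hV2']; abel
  have hZ' : projL s.calM * projL s.calS * W7 + W8 * projR s.calD +
      (s.calM† * s.calE * s.calD† + s.calS† * s.calS * s.calC† * s.calE * s.calN†
        + projL s.calM * W4 * projR s.calN) = T2 := by
    rw [hT2']; abel
  -- `V2` is affine in `W5`, `W6`, and `T2` in `W7`, `W8`. Eliminating these leaves two conditions
  -- on `W4` alone, `h77` and `h99`.
  rw [← hZ, mul_add_mul_eq_iff_of_affine hN hM, ← e66] at hV2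
  rw [← hZ', mul_add_mul_eq_iff_of_affine hN hM, ← e88] at hT2
  obtain ⟨⟨⟨cV1, cV2⟩, cW⟩, H31, H32, H33, hW5, hW6⟩ := hV2
  obtain ⟨⟨⟨cT1, cT2⟩, cW'⟩, H41, H42, H43, hW7, hW8⟩ := hT2
  have h77 : s.A77 * W4 * s.B77 = s.E77 := (projR_mul_sub_mul_projL_eq_zero_iff _ _ _ _ _ _).1 cW
  have h99 : s.A99 * W4 * s.B99 = s.E99 := (projR_mul_sub_mul_projL_eq_zero_iff _ _ _ _ _ _).1 cW'
  obtain ⟨⟨c77, c77'⟩, Q1, Q2, hQ⟩ := (mul_mul_eq_iff _ _ _ _).1 h77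
  obtain ⟨⟨c99, c99'⟩, Q1', Q2', hQ'⟩ := (mul_mul_eq_iff _ _ _ _).1 h99
  -- the two expressions for `W4`
  obtain ⟨cQ, K1, K2, K3, hQ1, hQ2⟩ := (exists_add_eq_iff hN hM (projL s.A77) (-projL s.A99)
    (projR s.B77) (-projR s.B99) s.Et (-Q1) (-Q2)).1 ⟨-Q1', -Q2', by
      have := hQ.symm.trans hQ'
      rw [← sub_eq_zero] at this ⊢
      rw [← neg_eq_zero, ← this, Et]
      simp only [Matrix.mul_neg, Matrix.neg_mul]
      abel⟩
  refine ⟨⟨cW1, cW2, cW3, cG2, cG4, cG1, cG3, cF2, cF4, cF1, cF3, cE1, cE2, cE3, cE4, cX1, cX2,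
    cY1, cY2, cV1, cV2, cT1, cT2, c77, c77', c99, c99', cQ⟩, ?_⟩
  -- With all free tensors fixed, the dependent ones are identified from the innermost, `W4`,
  -- outwards, so that each formula refers only to tensors already in closed form.
  let p : FreeTensors dJ dQ dP dA dE dC dR dL dS dT dH dB dO dD :=
    ⟨K1, K2, K3, W1, W2, W3, H11, H12, H13, H21, H22, H23, H31, H32, H33, H41, H42, H43,
      T21, T31, T41, J21, J31, J41⟩
  have eQ1 : -Q1 = s.solQ1 p := hQ1
  have eQ2 : -Q2 = s.solQ2 p := hQ2
  have eW4 : W4 = s.solW4 p := by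
    rw [solW4, ← eQ1, ← eQ2, hQ]
    simp only [Matrix.mul_neg, Matrix.neg_mul, sub_neg_eq_add]
  subst eW4
  have eW5 : W5 = s.solW5 p := hW5
  have eW6 : W6 = s.solW6 p := hW6
  have eW7 : W7 = s.solW7 p := hW7
  have eW8 : W8 = s.solW8 p := hW8
  have eV2 : V2 = s.solV2 p := by rw [hV2', eW5, eW6]; rfl
  have eT2 : T2 = s.solT2 p := by rw [hT2', eW7, eW8]; rfl
  rw [eV2, eT2] at hV1 hV3
  rw [eV2] at hU1 hU2 hU5
  rw [eT2] at hU3 hU4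
  have eV1 : V1 = s.solV1 p := hV1
  have eV3 : V3 = s.solV3 p := hV3
  have eU1 : U1 = s.solU1 p := hU1
  have eU2 : U2 = s.solU2 p := hU2
  have eU3 : U3 = s.solU3 p := hU3
  have eU4 : U4 = s.solU4 p := hU4
  have eU5 : U5 = s.solU5 p := by rw [hU5, eV1, eV3]; rfl
  have eX3 : X3 = s.solX3 p := by rw [hX3, eU1, eU2]; rfl
  have eY3 : Y3 = s.solY3 p := by rw [hY3, eU3, eU4]; rfl
  have eW : W = s.solW p := by rw [hW, eU5]; rfl
  rw [eX3, eW] at hX1 hX2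
  rw [eY3, eW] at hY1 hY2
  exact ⟨p, hX1, hX2, eX3, hY1, hY2, eY3, eW⟩

theorem isSolution_sol (hN : 0 < N) (hM : 0 < M) (h : s.SolvabilityConditions)
    (p : FreeTensors dJ dQ dP dA dE dC dR dL dS dT dH dB dO dD) :
    s.IsSolution (s.solX1 p) (s.solX2 p) (s.solX3 p) (s.solY1 p) (s.solY2 p) (s.solY3 p)
      (s.solW p) := by
  obtain ⟨cW1, cW2, cW3, cG2, cG4, cG1, cG3, cF2, cF4, cF1, cF3, cE1, cE2, cE3, cE4, cX1, cX2,
    cY1, cY2, cV1, cV2, cT1, cT2, c77, c77', c99, c99', cQ⟩ := h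
  -- The same equivalences are now read backwards from the inside. The second blocks `Q1'`, `Q2'`
  -- supply the other representation of `W4`, hence its second equation.
  obtain ⟨Q1', Q2', hQ⟩ := (exists_add_eq_iff hN hM (projL s.A77) (-projL s.A99)
    (projR s.B77) (-projR s.B99) s.Et (s.solQ1 p) (s.solQ2 p)).2 ⟨cQ, p.K1, p.K2, p.K3, rfl, rfl⟩
  have h77 : s.A77 * s.solW4 p * s.B77 = s.E77 :=
    (mul_mul_eq_iff _ _ _ _).2 ⟨⟨c77, c77'⟩, -s.solQ1 p, -s.solQ2 p, by
      rw [solW4]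
      simp only [Matrix.mul_neg, Matrix.neg_mul, ← sub_eq_add_neg]⟩
  have h99 : s.A99 * s.solW4 p * s.B99 = s.E99 :=
    (mul_mul_eq_iff _ _ _ _).2 ⟨⟨c99, c99'⟩, -Q1', -Q2', by
      rw [← sub_eq_zero] at hQ ⊢
      rw [← neg_eq_zero, ← hQ, Et, solW4]
      simp only [Matrix.mul_neg, Matrix.neg_mul]
      abel⟩
  have hV2 : s.A33 * s.solV2 p * s.B33 = s.E33 := by
    have e66 : s.E66 - s.C66 * s.solW4 p * s.D66 = s.A33† * s.E33 * s.B33† -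
        (s.calA† * s.calE * s.calB†
          - s.calA† * s.calS * s.calC† * s.calE * s.calN† * s.calD * s.calB†
          - s.calA† * s.calC * s.calM† * s.calE * s.calB†
          - s.calA† * s.calS * s.solW4 p * projR s.calN * s.calD * s.calB†) := by
      rw [E66, C66, D66]
      simp only [Matrix.neg_mul, Matrix.mul_assoc]
      abel
    have hZ : projL s.calA * s.solW5 p + s.solW6 p * projR s.calB + (s.calA† * s.calE * s.calB†
        - s.calA† * s.calS * s.calC† * s.calE * s.calN† * s.calD * s.calB†
        - s.calA† * s.calC * s.calM† * s.calE * s.calB†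
        - s.calA† * s.calS * s.solW4 p * projR s.calN * s.calD * s.calB†) = s.solV2 p := by
      rw [solV2]; abel
    rw [← hZ, mul_add_mul_eq_iff_of_affine hN hM, ← e66]
    exact ⟨⟨⟨cV1, cV2⟩, (projR_mul_sub_mul_projL_eq_zero_iff _ _ _ _ _ _).2 h77⟩,
      p.H31, p.H32, p.H33, rfl, rfl⟩
  have hT2 : s.A55 * s.solT2 p * s.B55 = s.E55 := by
    have e88 : s.E88 - s.C88 * s.solW4 p * s.D88 = s.A55† * s.E55 * s.B55† -
        (s.calM† * s.calE * s.calD† + s.calS† * s.calS * s.calC† * s.calE * s.calN†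
          + projL s.calM * s.solW4 p * projR s.calN) := by
      rw [E88, C88, D88]
      abel
    have hZ : projL s.calM * projL s.calS * s.solW7 p + s.solW8 p * projR s.calD +
        (s.calM† * s.calE * s.calD† + s.calS† * s.calS * s.calC† * s.calE * s.calN†
          + projL s.calM * s.solW4 p * projR s.calN) = s.solT2 p := by
      rw [solT2]; abel
    rw [← hZ, mul_add_mul_eq_iff_of_affine hN hM, ← e88]
    exact ⟨⟨⟨cT1, cT2⟩, (projR_mul_sub_mul_projL_eq_zero_iff _ _ _ _ _ _).2 h99⟩,
      p.H41, p.H42, p.H43, rfl, rfl⟩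
  have hE : s.calA * s.solV2 p * s.calB + s.calC * s.solT2 p * s.calD = s.calE :=
    (mul_mul_add_mul_mul_eq_iff s.calA s.calB s.calC s.calD s.calE (R := s.calM) (T := s.calN)
      (S := s.calS) rfl rfl rfl _ _).2 ⟨⟨cE1, cE2, cE3, cE4⟩, s.solW4 p, s.solW5 p, s.solW6 p,
        s.solW7 p, s.solW8 p, rfl, rfl⟩
  -- The second blocks recovered here and in the next two steps give the alternative expressions for
  -- `U5`, `X3` and `Y3` needed in `hG` and `hF`.
  obtain ⟨T1, T3, hT⟩ := (exists_add_eq_iff' hN hM (projL s.M1 * projL s.S1)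
    (projL s.M2 * projL s.S2) (projR s.D6) (projR s.D7)
    (s.E11 - projL s.M1 * s.solV2 p * projR s.N1 - projL s.M2 * s.solT2 p * projR s.N2)
    (s.solV1 p) (s.solV3 p)).2
    ⟨(projR_mul_sub_sub_mul_projL_eq_zero_iff _ _ _ _ _ _ _ _ _).2 hE, p.W1, p.W2, p.W3, rfl, rfl⟩
  obtain ⟨U1', U2', hU⟩ := (exists_add_eq_iff hN hM (projL s.A1) (projL s.A4h)
    (projR s.B1) (projR s.B4h) (s.E22 - s.C22 * s.solV2 p * s.D22) (s.solU1 p) (s.solU2 p)).2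
    ⟨(projR_mul_sub_mul_projL_eq_zero_iff _ _ _ _ _ _).2 hV2, p.H11, p.H12, p.H13, rfl, rfl⟩
  obtain ⟨U3', U4', hU'⟩ := (exists_add_eq_iff hN hM (projL s.A2) (projL s.A5h)
    (projR s.B2) (projR s.B5h) (s.E44 - s.C44 * s.solT2 p * s.D44) (s.solU3 p) (s.solU4 p)).2
    ⟨(projR_mul_sub_mul_projL_eq_zero_iff _ _ _ _ _ _).2 hT2, p.H21, p.H22, p.H23, rfl, rfl⟩
  have hG : s.A4h * s.solX3 p * s.B4h + s.C6 * s.solU5 p * s.D6 = s.calG :=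
    (mul_mul_add_mul_mul_eq_iff s.A4h s.B4h s.C6 s.D6 s.calG (R := s.M1) (T := s.N1) (S := s.S1)
      rfl rfl rfl _ _).2 ⟨⟨cG1, cG2, cG3, cG4⟩, s.solV2 p, -U1', -U2', s.solV1 p, s.solV3 p, by
        rw [← sub_eq_zero] at hU ⊢
        rw [← hU, solX3, E22, C22, D22]
        simp only [Matrix.mul_neg, Matrix.neg_mul, Matrix.mul_assoc]
        abel, rfl⟩
  have hF : s.A5h * s.solY3 p * s.B5h + s.C7 * s.solU5 p * s.D7 = s.calF :=
    (mul_mul_add_mul_mul_eq_iff s.A5h s.B5h s.C7 s.D7 s.calF (R := s.M2) (T := s.N2) (S := s.S2)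
      rfl rfl rfl _ _).2 ⟨⟨cF1, cF2, cF3, cF4⟩, -s.solT2 p, -U3', -U4', -T1, -T3, by
        rw [← sub_eq_zero] at hU' ⊢
        rw [← hU', solY3, E44, C44, D44]
        simp only [Matrix.mul_neg, Matrix.neg_mul, Matrix.mul_assoc]
        abel, by
        rw [← sub_eq_zero] at hT ⊢
        rw [← hT, solU5, E11]
        simp only [Matrix.mul_neg, Matrix.neg_mul]
        abel⟩
  have hW := (mul_eq_and_mul_eq_iff s.A3 s.B3 s.E3 s.E4 (s.solW p)).2
    ⟨⟨cW1, cW2, cW3⟩, s.solU5 p, rfl⟩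
  exact ⟨(mul_mul_eq_iff _ _ _ _).2 ⟨⟨cX1, cX2⟩, s.solU1 p, s.solU2 p, rfl⟩,
    (mul_mul_eq_iff _ _ _ _).2 ⟨⟨cY1, cY2⟩, s.solU3 p, s.solU4 p, rfl⟩, hW.1, hW.2,
    (sylvester_eq_iff _ _ _ _ _ _ _ _ _ _ _).2
      ⟨(add_mul_mul_eq_iff_of_affine _ _ _ _ _ _ _ _ _).2 hG, p.T21, p.T31, p.T41, rfl, rfl⟩,
    (sylvester_eq_iff _ _ _ _ _ _ _ _ _ _ _).2
      ⟨(add_mul_mul_eq_iff_of_affine _ _ _ _ _ _ _ _ _).2 hF, p.J21, p.J31, p.J41, rfl, rfl⟩⟩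

end SylvesterData

theorem theorem4p1 {N M : ℕ} (hN : 0 < N) (hM : 0 < M)
    {dI dJ dQ dP dA dE dC dR : Fin N → ℕ} {dL dK dS dT dH dB dO dD : Fin M → ℕ}
    (s : SylvesterData dI dJ dQ dP dA dE dC dR dL dK dS dT dH dB dO dD) :
    ((∃ X1 X2 X3 Y1 Y2 Y3 W, s.IsSolution X1 X2 X3 Y1 Y2 Y3 W) ↔ s.SolvabilityConditions) ∧
    (s.SolvabilityConditions → ∀ X1 X2 X3 Y1 Y2 Y3 W,
      s.IsSolution X1 X2 X3 Y1 Y2 Y3 W ↔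
        ∃ p : FreeTensors dJ dQ dP dA dE dC dR dL dS dT dH dB dO dD,
          X1 = s.solX1 p ∧ X2 = s.solX2 p ∧ X3 = s.solX3 p ∧
          Y1 = s.solY1 p ∧ Y2 = s.solY2 p ∧ Y3 = s.solY3 p ∧ W = s.solW p) := by
  refine ⟨⟨?_, fun h => ?_⟩, fun h X1 X2 X3 Y1 Y2 Y3 W => ⟨fun hs => ?_, ?_⟩⟩
  · rintro ⟨X1, X2, X3, Y1, Y2, Y3, W, hs⟩
    exact (s.exists_eq_sol_of_isSolution hN hM hs).1
  -- Any choice of free tensors gives a solution; zero is the simplest.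
  · exact ⟨_, _, _, _, _, _, _, s.isSolution_sol hN hM h ⟨0, 0, 0, 0, 0, 0, 0, 0, 0, 0, 0, 0, 0, 0,
      0, 0, 0, 0, 0, 0, 0, 0, 0, 0⟩⟩
  · exact (s.exists_eq_sol_of_isSolution hN hM hs).2
  · rintro ⟨p, rfl, rfl, rfl, rfl, rfl, rfl, rfl⟩
    exact s.isSolution_sol hN hM h p
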